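/- **Proposition ($\beta$-term formula).** Let $w=(w_1,\dots,w_5)$ be positive integers with $w_5=1$ and $w_i\mid d$ for all $i$, where $d=w_1+\cdots+w_5$. Let $\Delta^*\subset\mathbb R^4$ be the convex hull of $v_1^*=e_1,\dots,v_4^*=e_4$, $v_5^*=(-w_1,-w_2,-w_3,-w_4)$; let $v_0^*=0,v_1^*,\dots,v_5^*,v_6^*,\dots$ be all its integral points, without repetition. Let $v_\rho=\frac{d}{w_\rho}e_\rho-(1,1,1,1)$ for $\rho\le 4$ and $v_5=-(1,1,1,1)$. On $\mathbb C^5$ with coordinates $z_1,\dots,z_5$, homogeneous coordinates of $\mathbb P^4(w)$, put $$\Pi(a)=\frac{\Omega_0}{\sum_k a_k\prod_{\rho=1}^5 z_\rho^{\langle v_k^*,v_\rho\rangle+1}},\qquad \Omega_0=\sum_{\rho=1}^5(-1)^{\rho-1}w_\rho z_\rho\,dz_1\wedge\cdots\widehat{dz_\rho}\cdots\wedge dz_5 .$$ Let $a=(a_k)$ range over an open set $U$ of parameters with all $a_k\neq0$, on which holomorphic branches of $\log(a_0/a_\rho)$, $1\le\rho\le5$, are fixed. Let $\phi:z_\rho\mapsto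 (a_0/a_\rho)^{w_\rho/d}z_\rho$ and $\tilde\Pi=a_0\,\phi^*\Pi(a)$. Let $l=(l_k)$ be integers with $\sum_k l_k=0$, $\sum_k l_kv_k^*=0$; write $\theta_k=a_k\partial/\partial a_k$, $a^l=\prod_k a_k^{l_k}$, and $$\tilde D_l=\prod_{j=1}^{l_0}(\theta_0-j)\prod_{k\ne0,\,l_k>0}\ \prod_{j=0}^{l_k-1}(\theta_k-j)\;-\;a^l\prod_{j=1}^{-l_0}(\theta_0-j)\prod_{k\neq0,\,l_k<0}\ \prod_{j=0}^{-l_k-1}(\theta_k-j),$$ where empty products are $1$. Let $X_i=\frac{w_i}{d}z_i\frac{\partial}{\partial z_i}$ for $1\le i\le 5$. Define 4-forms $\alpha_1,\dots,\alpha_5$ as follows. List the factors of the first product as $A_1,\dots,A_n$, where each $A_r$ is of the form $\theta_{k_r}-j_r$ and the factors are ordered with those of $k=0$ first, then $k=1,\dots,5$, then the others. Let $B_r=A_r+\mathcal L_{X_{k_r}}$ if $1\le k_r\le5$ and $B_r=A_r$ otherwise, and put $$R_i^+=\sum_{r:\,k_r=i}B_1\cdots B_{r-1}\,A_{r+1}\cdots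 A_n .$$ Let $R_i^-$ be the same operator for the second product (without the factor $a^l$), and put $\alpha_i=R_i^+\tilde\Pi-a^lR_i^-\tilde\Pi$ and $$\beta_l=\sum_{i=1}^5\iota_{X_i}\alpha_i .$$ Let $d$ and $\mathcal L$ act along $z$ only. Then the set of $(a,z)$, $a\in U$, off the polar locus of $\tilde\Pi$ is open, and on it $\tilde\Pi$, the $\alpha_i$ and $\beta_l$ are holomorphic in $(a,z)$, the $\alpha_i$ are $d$-closed, and $$\tilde D_l\tilde\Pi=-\sum_{i=1}^5\mathcal L_{X_i}\alpha_i=-d\beta_l .$$ Moreover $\iota_E\beta_l=0$ and $\mathcal L_E\beta_l=0$ for the Euler field $E=\sum_\rho w_\rho z_\rho\,\partial/\partial z_\rho$. Finally, at every $(a,z)$ of this set, if $\alpha_1',\dots,\alpha_5'$ are any 4-forms that are differentiable at $z$ and satisfy $d\alpha_i'=0$ and $\tilde D_l\tilde\Pi=-\sum_i\mathcal L_{X_i}\alpha_i'$ at $z$, then $\tilde D_l\tilde\Pi=-d\sum_i\iota_{X_i}\alpha_i'$ at $z$. -/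

import Mathlib

noncomputable section

namespace BetaTerm

/-- Affine space of homogeneous coordinates `z = (z_1, ..., z_5)`. -/
abbrev Vec := Fin 5 → ℂ

/-- Differential forms of type `(k, 0)` in the homogeneous coordinates. -/
abbrev Form (k : ℕ) := Vec → Vec [⋀^Fin k]→L[ℂ] ℂ

/-! ### Toric data -/

/-- The degree `d = w_1 + ... + w_5`. -/
def deg (w : Fin 5 → ℕ) : ℕ := ∑ ρ, w ρ

/-- The vertices `v_ρ` of `Δ`: `v_ρ = (d / w_ρ) e_ρ - (1,1,1,1)` for `ρ ≤ 4`, and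
`v_5 = (-1,-1,-1,-1)`. -/
def ray (w : Fin 5 → ℕ) (ρ : Fin 5) (j : Fin 4) : ℤ :=
  (if ρ = j.castSucc then ((deg w / w ρ : ℕ) : ℤ) else 0) - 1

/-- The vertices `v*_ρ` of `Δ*`: the unit vectors for `ρ ≤ 4`, and
`v*_5 = (-w_1, -w_2, -w_3, -w_4)`. -/
def dualVertex (w : Fin 5 → ℕ) (ρ : Fin 5) (j : Fin 4) : ℤ :=
  if ρ = Fin.last 4 then -(w j.castSucc : ℤ) else if ρ = j.castSucc then 1 else 0

/-- The integral points of the polytope `Δ*`, the convex hull of the `v*_ρ`. -/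
def dualPoints (w : Fin 5 → ℕ) : Set (Fin 4 → ℤ) :=
  {v | (fun j => (v j : ℝ)) ∈ convexHull ℝ (Set.range fun ρ j => (dualVertex w ρ j : ℝ))}

/-- The pairing `⟨v, v'⟩` of integral vectors. -/
def pairing (v v' : Fin 4 → ℤ) : ℤ := ∑ j, v j * v' j

/-- Labels of the integral points of `Δ*`: the origin, the five vertices, and `N` further points. -/
abbrev Idx (N : ℕ) := Option (Fin 5 ⊕ Fin N)

/-- The label of the origin `v*_0`. -/
abbrev origin {N : ℕ} : Idx N := none

/-- The label of the vertex `v*_ρ`. -/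
abbrev vertex {N : ℕ} (ρ : Fin 5) : Idx N := some (Sum.inl ρ)

/-- The label of a further point. -/
abbrev other {N : ℕ} (k : Fin N) : Idx N := some (Sum.inr k)

/-- The integral point `v*_k`, where `u` lists the points other than the origin and the vertices. -/
def point (w : Fin 5 → ℕ) {N : ℕ} (u : Fin N → Fin 4 → ℤ) : Idx N → Fin 4 → ℤ
  | none => 0
  | some (Sum.inl ρ) => dualVertex w ρ
  | some (Sum.inr k) => u k

/-- `u` lists, without repetition, all integral points of `Δ*` other than the origin and the
vertices. -/
def IsEnumeration (w : Fin 5 → ℕ) {N : ℕ} (u : Fin N → Fin 4 → ℤ) : Prop :=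
  Function.Injective u ∧
    Set.range u = {v | v ∈ dualPoints w ∧ v ≠ 0 ∧ ∀ ρ, v ≠ dualVertex w ρ}

/-- The relation lattice `L`: integral relations among the vectors `(1, v*_k)`. -/
def relationLattice (w : Fin 5 → ℕ) {N : ℕ} (u : Fin N → Fin 4 → ℤ) : Set (Idx N → ℤ) :=
  {l | ∑ k, l k = 0 ∧ ∑ k, l k • point w u k = 0}

/-! ### Forms, pullbacks, contractions, Lie derivatives -/

/-- The diagonal linear map `z_ρ ↦ c_ρ z_ρ`. -/
def diag (c : Fin 5 → ℂ) : Vec →L[ℂ] Vec :=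
  ContinuousLinearMap.pi fun ρ => c ρ • ContinuousLinearMap.proj (R := ℂ) (φ := fun _ => ℂ) ρ

/-- The pullback of a form under a linear map (whose differential at each point is itself). -/
def pullback {k : ℕ} (A : Vec →L[ℂ] Vec) (ω : Form k) : Form k :=
  fun z => (ω (A z)).compContinuousLinearMap A

/-- The contraction `ι_X ω`. -/
def interior {k : ℕ} (X : Vec → Vec) (ω : Form (k + 1)) : Form k :=
  fun z => (ω z).curryLeft (X z)

/-- The diagonal vector field `∑_ρ c_ρ z_ρ ∂/∂z_ρ`. -/
def diagField (c : Fin 5 → ℂ) : Vec → Vec := fun z ρ => c ρ * z ρ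

/-- The flow `z_ρ ↦ e^{t c_ρ} z_ρ`. -/
def diagFlow (c : Fin 5 → ℂ) (t : ℂ) : Vec →L[ℂ] Vec := diag fun ρ => Complex.exp (t * c ρ)

/-- `diagFlow c` is the flow of the vector field `diagField c`. -/
theorem diagFlow_isFlow (c : Fin 5 → ℂ) (z : Vec) :
    diagFlow c 0 z = z ∧
      ∀ t, HasDerivAt (fun s => diagFlow c s z) (diagField c (diagFlow c t z)) t := by
  constructor
  · ext ρ
    simp [diagFlow, diag]
  · intro t
    rw [hasDerivAt_pi]
    intro ρ
    have h := (((hasDerivAt_id t).mul_const (c ρ)).cexp).mul_const (z ρ)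
    simpa [diagFlow, diag, diagField, mul_comm, mul_left_comm, mul_assoc] using h

/-- The Lie derivative of a form along `diagField c`: the derivative at `t = 0` of its pullback
under the flow. -/
def lieDeriv {k : ℕ} (c : Fin 5 → ℂ) (ω : Form k) : Form k :=
  fun z => deriv (fun t => pullback (diagFlow c t) ω z) 0

/-- The coefficients of the vector field `(w_i / d) z_i ∂/∂z_i`. -/
def coordCoeff (w : Fin 5 → ℕ) (i : Fin 5) : Fin 5 → ℂ :=
  Pi.single i ((w i : ℂ) / (deg w : ℂ))

/-- The coefficients of the Euler vector field `∑_ρ w_ρ z_ρ ∂/∂z_ρ`. -/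
def eulerCoeff (w : Fin 5 → ℕ) : Fin 5 → ℂ := fun ρ => (w ρ : ℂ)

/-- The constant form `dz_1 ∧ ... ∧ dz_5` with the factor `dz_ρ` omitted. -/
def dzHat (ρ : Fin 5) : Vec [⋀^Fin 4]→L[ℂ] ℂ where
  toAlternatingMap := (Matrix.detRowAlternating (n := Fin 4) (R := ℂ)).compLinearMap
    (LinearMap.funLeft ℂ ℂ ρ.succAbove)
  cont := by
    change Continuous fun m : Fin 4 → Vec =>
      Matrix.det (Matrix.of fun i j => m i (ρ.succAbove j))
    fun_prop

/-- `Ω_0 = ∑_ρ (-1)^{ρ-1} w_ρ z_ρ dz_1 ∧ ... (omit dz_ρ) ... ∧ dz_5`. (Here `ρ` runs from `0`.) -/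
def omegaZero (w : Fin 5 → ℕ) : Form 4 :=
  fun z => ∑ ρ : Fin 5, ((-1) ^ (ρ : ℕ) * (w ρ : ℂ) * z ρ) • dzHat ρ

/-! ### The Calabi-Yau family -/

/-- The defining polynomial `∑_k a_k ∏_ρ z_ρ^{⟨v*_k, v_ρ⟩ + 1}`; the exponents are nonnegative for
points of `Δ*`. -/
def cyPoly (w : Fin 5 → ℕ) {N : ℕ} (u : Fin N → Fin 4 → ℤ) (a : Idx N → ℂ) (z : Vec) : ℂ :=
  ∑ k, a k * ∏ ρ, z ρ ^ (pairing (point w u k) (ray w ρ) + 1)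

/-- The rational form `Π(a)`. -/
def piForm (w : Fin 5 → ℕ) {N : ℕ} (u : Fin N → Fin 4 → ℤ) (a : Idx N → ℂ) : Form 4 :=
  fun z => (cyPoly w u a z)⁻¹ • omegaZero w z

/-- `lam ρ` is, on `U`, a holomorphic branch of `log (a_0 / a_ρ)`. -/
def IsLogBranch {N : ℕ} (U : Set (Idx N → ℂ)) (lam : Fin 5 → (Idx N → ℂ) → ℂ) : Prop :=
  ∀ ρ, DifferentiableOn ℂ (lam ρ) U ∧
    ∀ a ∈ U, Complex.exp (lam ρ a) = a origin / a (vertex ρ)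

/-- The automorphism `z_ρ ↦ (a_0 / a_ρ)^{w_ρ / d} z_ρ`, with the powers given by the branches
`lam ρ` of `log (a_0 / a_ρ)`. -/
def autom (w : Fin 5 → ℕ) {N : ℕ} (lam : Fin 5 → (Idx N → ℂ) → ℂ) (a : Idx N → ℂ) :
    Vec →L[ℂ] Vec :=
  diag fun ρ => Complex.exp ((w ρ : ℂ) / (deg w : ℂ) * lam ρ a)

/-- Families of forms depending on the parameters `a`. -/
abbrev Family (N k : ℕ) := (Idx N → ℂ) → Form k

/-- The normalized form: `a_0` times the pullback of `Π(a)` under the automorphism. -/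
def piTilde (w : Fin 5 → ℕ) {N : ℕ} (u : Fin N → Fin 4 → ℤ)
    (lam : Fin 5 → (Idx N → ℂ) → ℂ) : Family N 4 :=
  fun a => a origin • pullback (autom w lam a) (piForm w u a)

/-- The set of `(a, z)`, `a ∈ U`, off the polar locus of the normalized form. -/
def regularSet (w : Fin 5 → ℕ) {N : ℕ} (u : Fin N → Fin 4 → ℤ) (U : Set (Idx N → ℂ))
    (lam : Fin 5 → (Idx N → ℂ) → ℂ) : Set ((Idx N → ℂ) × Vec) :=
  {p | p.1 ∈ U ∧ cyPoly w u p.1 (autom w lam p.1 p.2) ≠ 0}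

/-! ### GKZ operators -/

/-- The operator `a_k ∂/∂a_k`. -/
def theta {N m : ℕ} (k : Idx N) (F : Family N m) : Family N m :=
  fun a z => a k • fderiv ℂ (fun b => F b z) a (Pi.single k 1)

/-- Lie derivative, along `(w_i / d) z_i ∂/∂z_i`, of each member of a family. -/
def lie (w : Fin 5 → ℕ) {N m : ℕ} (i : Fin 5) (F : Family N m) : Family N m :=
  fun a => lieDeriv (coordCoeff w i) (F a)

/-- The factor `a_k ∂/∂a_k - j`, labelled by `(k, j)`. -/
def factor {N m : ℕ} (f : Idx N × ℕ) (F : Family N m) : Family N m :=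
  theta f.1 F - (f.2 : ℂ) • F

/-- The factor `a_k ∂/∂a_k - j + L`, where `L` is the Lie derivative along
`(w_i / d) z_i ∂/∂z_i` if `k` is the vertex `i`, and zero otherwise. -/
def lieFactor (w : Fin 5 → ℕ) {N m : ℕ} (f : Idx N × ℕ) (F : Family N m) : Family N m :=
  factor f F + ∑ i, if f.1 = vertex i then lie w i F else 0

/-- The composite of the operators `T f`, `f` running through a list. -/
def compose {N m : ℕ} (T : Idx N × ℕ → Family N m → Family N m) (fs : List (Idx N × ℕ))
    (F : Family N m) : Family N m :=
  fs.foldr T F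

/-- The labels of the factors with `l_k > 0`: `(0, j)`, `1 ≤ j ≤ l_0`, for the origin and
`(k, j)`, `0 ≤ j < l_k`, for the other points. -/
def factors {N : ℕ} (l : Idx N → ℤ) : List (Idx N × ℕ) :=
  (List.range (l origin).toNat).map (fun j => (origin, j + 1)) ++
  (List.finRange 5).flatMap
    (fun i => (List.range (l (vertex i)).toNat).map fun j => (vertex i, j)) ++
  (List.finRange N).flatMap
    (fun k => (List.range (l (other k)).toNat).map fun j => (other k, j))

/-- The monomial `a^l`. -/
def monomial {N : ℕ} (l : Idx N → ℤ) (a : Idx N → ℂ) : ℂ := ∏ k, a k ^ l k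

/-- The rescaled GKZ operator
`∏_{j=1}^{l_0} (θ_0 - j) ∏_{k ≠ 0, l_k > 0} ∏_{j=0}^{l_k - 1} (θ_k - j)
  - a^l ∏_{j=1}^{-l_0} (θ_0 - j) ∏_{k ≠ 0, l_k < 0} ∏_{j=0}^{-l_k - 1} (θ_k - j)`,
where `θ_k = a_k ∂/∂a_k`. -/
def gkz {N m : ℕ} (l : Idx N → ℤ) (F : Family N m) : Family N m :=
  fun a => compose factor (factors l) F a - monomial l a • compose factor (factors (-l)) F a

/-- Write `A_f` and `A_f + L_f` for the two kinds of factors. In the expansion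
`∏_f (A_f + L_f) - ∏_f A_f = ∑_r L_{f_r} ∏_{s < r} (A_{f_s} + L_{f_s}) ∏_{s > r} A_{f_s}`
this is the operator multiplying the Lie derivative along `(w_i / d) z_i ∂/∂z_i`. -/
def lieCofactor (w : Fin 5 → ℕ) {N m : ℕ} (i : Fin 5) (fs : List (Idx N × ℕ))
    (F : Family N m) : Family N m :=
  ∑ r : Fin fs.length, if (fs.get r).1 = vertex i then
    compose (lieFactor w) (fs.take r) (compose factor (fs.drop (r + 1)) F) else 0

/-- The forms `α_i`. -/
def alpha (w : Fin 5 → ℕ) {N : ℕ} (u : Fin N → Fin 4 → ℤ) (lam : Fin 5 → (Idx N → ℂ) → ℂ)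
    (l : Idx N → ℤ) (i : Fin 5) : Family N 4 :=
  fun a => lieCofactor w i (factors l) (piTilde w u lam) a
    - monomial l a • lieCofactor w i (factors (-l)) (piTilde w u lam) a

/-- `∑_i ι_{(w_i / d) z_i ∂/∂z_i} α_i`. -/
def contractSum (w : Fin 5 → ℕ) (α : Fin 5 → Form 4) : Form 3 :=
  ∑ i, interior (diagField (coordCoeff w i)) (α i)

/-- The form `β_l`. -/
def beta (w : Fin 5 → ℕ) {N : ℕ} (u : Fin N → Fin 4 → ℤ) (lam : Fin 5 → (Idx N → ℂ) → ℂ)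
    (l : Idx N → ℤ) : Family N 3 :=
  fun a => contractSum w fun i => alpha w u lam l i a

end BetaTerm

end

noncomputable section

namespace BetaTerm

open Filter Topology TopologicalSpace

/-! ### Diagonal vector fields and Cartan's formula -/

/-! The automorphism is chosen so that `a_k ∂/∂a_k`, applied before the pullback, has a simple
counterpart after it. The `a_i`-dependence of the automorphism moves the form along `-X_i`, so for a
vertex `θ_i + L_{X_i}` is the pulled-back operator. The dependence on `a_0` moves it along the Euler
field divided by `d`, under which the form is invariant, so only the prefactor `a_0` matters and the
counterpart is `θ_0 - 1`. This is why the factors for the origin start at `j = 1`. Hence the product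
of the `B_r` sends the normalized form to `a_0` times the pullback of `∏ a_k^{n_k} ∂_k^{n_k} Π`,
with `n` the positive part of `l` (`prod_factors_coeff`). The positive and negative parts of a
relation have equal total order and give the same monomial in `z`, so the two results differ exactly
by `a^l` (`inverseDeriv_toNat`): the operator built from the `B_r` kills the form. Replacing each
`B_r` by `A_r` costs a telescoping sum in which every summand contains one Lie derivative, and since
all operators commute it can be pulled out in front (`sum_lieDerivOp_mul_lieCofactorOp`). This gives
the Lie derivative formula (`isCoeff_gkz`). The `α_i` are multiples of `Ω_0` of Euler degree zero,
hence closed, and Cartan's formula turns each `L_{X_i} α_i` into `d ι_{X_i} α_i`. That `β_l` is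
horizontal follows from `ι_E Ω_0 = 0`; its invariance follows from Cartan's formula once more, as
`dβ_l` is a multiple of `Ω_0`. The calculation is scalar: each 4-form is written `g Ω_0`, and the
operators act on `g` as derivations along commuting linear vector fields plus constants, inside the
endomorphism ring of the analytic functions on the regular set. -/

@[simp]
theorem diag_apply (c : Fin 5 → ℂ) (z : Vec) (ρ : Fin 5) : diag c z ρ = c ρ * z ρ := by
  simp [diag]

theorem diagField_eq (c : Fin 5 → ℂ) (z : Vec) : diagField c z = diag c z := by
  ext ρ
  simp [diagField]

theorem diagFlow_zero (c : Fin 5 → ℂ) : diagFlow c 0 = ContinuousLinearMap.id ℂ Vec := by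
  ext z ρ
  simp [diagFlow]

/-- `diag` as a continuous linear map. -/
def diagCLM : (Fin 5 → ℂ) →L[ℂ] Vec →L[ℂ] Vec :=
  LinearMap.toContinuousLinearMap
    { toFun := diag
      map_add' := fun c c' => by ext; simp [add_mul]
      map_smul' := fun t c => by ext; simp [mul_assoc] }

theorem hasDerivAt_diagFlow (c : Fin 5 → ℂ) : HasDerivAt (diagFlow c) (diag c) 0 := by
  have h : HasDerivAt (fun t : ℂ => fun ρ => Complex.exp (t * c ρ)) c 0 := by
    rw [hasDerivAt_pi]
    intro ρ
    simpa using ((hasDerivAt_id (0 : ℂ)).mul_const (c ρ)).cexp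
  exact (diagCLM.hasFDerivAt.comp_hasDerivAt 0 h :)

theorem hasDerivAt_pullback_diagFlow {k : ℕ} (c : Fin 5 → ℂ) {ω : Form k} {z : Vec}
    (hω : DifferentiableAt ℂ ω z) :
    HasDerivAt (fun t => pullback (diagFlow c t) ω z)
      (fderiv ℂ ω z (diagField c z) +
        (ω z).fderivCompContinuousLinearMap (ContinuousLinearMap.id ℂ Vec) (diag c)) 0 := by
  have h₁ : HasDerivAt (fun t => diagFlow c t z) (diagField c z) 0 := by
    simpa [diagFlow_zero] using (diagFlow_isFlow c z).2 0
  have h₂ : HasFDerivAt ω (fderiv ℂ ω z) (diagFlow c 0 z) := by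
    simpa [diagFlow_zero] using hω.hasFDerivAt
  have h := ((h₂.comp_hasDerivAt 0 h₁).hasFDerivAt.continuousAlternatingMapCompContinuousLinearMap
    (hasDerivAt_diagFlow c).hasFDerivAt).hasDerivAt
  convert! h using 1
  ext v
  simp [diagFlow_zero]

theorem lieDeriv_eq {k : ℕ} (c : Fin 5 → ℂ) {ω : Form k} {z : Vec}
    (hω : DifferentiableAt ℂ ω z) :
    lieDeriv c ω z = fderiv ℂ ω z (diagField c z) +
        (ω z).fderivCompContinuousLinearMap (ContinuousLinearMap.id ℂ Vec) (diag c) :=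
  (hasDerivAt_pullback_diagFlow c hω).deriv

theorem hasFDerivAt_interior {k : ℕ} (c : Fin 5 → ℂ) {ω : Form (k + 1)} {z : Vec}
    (hω : DifferentiableAt ℂ ω z) :
    HasFDerivAt (interior (diagField c) ω)
      ((ω z).curryLeft ∘L diag c +
        ((ContinuousAlternatingMap.curryLeftLI.toContinuousLinearMap ∘L fderiv ℂ ω z).flip
          (diagField c z))) z := by
  have h₁ : HasFDerivAt (fun y => (ω y).curryLeft)
      (ContinuousAlternatingMap.curryLeftLI.toContinuousLinearMap ∘L fderiv ℂ ω z) z :=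
    HasFDerivAt.comp (g := fun η : Vec [⋀^Fin (k + 1)]→L[ℂ] ℂ => η.curryLeft) z
      (ContinuousAlternatingMap.curryLeftLI (𝕜 := ℂ) (E := Vec)
        (F := ℂ)).toContinuousLinearMap.hasFDerivAt hω.hasFDerivAt
  have h₂ : HasFDerivAt (diagField c) (diag c) z := by
    have : diagField c = diag c := funext (diagField_eq c)
    rw [this]
    exact (diag c).hasFDerivAt
  exact h₁.clm_apply h₂

/-- Cartan's formula for diagonal vector fields. -/
theorem lieDeriv_eq_extDeriv_interior {k : ℕ} (c : Fin 5 → ℂ) {ω : Form (k + 1)} {z : Vec}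
    (hω : DifferentiableAt ℂ ω z) :
    lieDeriv c ω z =
      interior (diagField c) (extDeriv ω) z + extDeriv (interior (diagField c) ω) z := by
  ext v
  rw [lieDeriv_eq c hω, extDeriv, (hasFDerivAt_interior c hω).fderiv]
  simp only [ContinuousAlternatingMap.add_apply, interior, extDeriv,
    ContinuousAlternatingMap.curryLeft_apply_apply,
    ContinuousAlternatingMap.alternatizeUncurryFin_apply]
  have h₁ : ∀ i : Fin (k + 1),
      (i.succ).removeNth (Matrix.vecCons (diagField c z) v : Fin (k + 2) → Vec) =
        Matrix.vecCons (diagField c z) (i.removeNth v) := by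
    intro i
    ext j : 1
    cases j using Fin.cases <;> simp [Fin.removeNth]
  have h₂ : ∀ i : Fin (k + 1),
      (fun j => Function.update (fun _ => ContinuousLinearMap.id ℂ Vec) i (diag c) j (v j)) =
        i.insertNth (diag c (v i)) (i.removeNth v) := by
    intro i
    ext j : 1
    cases j using Fin.succAboveCases i <;> simp [Fin.removeNth]
  -- The summand of `ι_X dω` differentiated in the direction `X` is the transport term of the Lie
  -- derivative; the other summands cancel the part of `d ι_X ω` that differentiates `ω`. The part
  -- that differentiates `X` is the remaining term.
  rw [Fin.sum_univ_succ]
  simp only [ContinuousAlternatingMap.fderivCompContinuousLinearMap_apply, h₂,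
    ContinuousAlternatingMap.map_insertNth, Matrix.cons_val_succ, h₁, Fin.val_succ, pow_succ]
  simp [Finset.sum_add_distrib, smul_add]
  ring

/-! ### Forms of top degree and `omegaZero` -/

/-- The determinant as a continuous alternating form. -/
def detForm (n : ℕ) : (Fin n → ℂ) [⋀^Fin n]→L[ℂ] ℂ where
  toAlternatingMap := Matrix.detRowAlternating (n := Fin n) (R := ℂ)
  cont := Continuous.matrix_det (A := fun m : Fin n → Fin n → ℂ => (m : Matrix (Fin n) (Fin n) ℂ))
    continuous_id

theorem detForm_apply {n : ℕ} (v : Fin n → Fin n → ℂ) :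
    detForm n v = Matrix.det (Matrix.of v) := rfl

/-- The constant form `dz_1 ∧ ... ∧ dz_5`. -/
def volForm : Vec [⋀^Fin 5]→L[ℂ] ℂ := detForm 5

theorem volForm_apply (v : Fin 5 → Vec) : volForm v = Matrix.det (Matrix.of v) :=
  detForm_apply v

theorem dzHat_apply (ρ : Fin 5) (v : Fin 4 → Vec) :
    dzHat ρ v = Matrix.det (Matrix.of fun i j => v i (ρ.succAbove j)) := rfl

/-- Laplace expansion along the first row. Seen as `ι_E` of the volume form, `Ω_0` inherits its
scaling under diagonal maps and satisfies `ι_E Ω_0 = 0`. -/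
theorem omegaZero_eq (w : Fin 5 → ℕ) :
    omegaZero w = interior (diagField (eulerCoeff w)) fun _ => volForm := by
  ext z v
  have h : interior (diagField (eulerCoeff w)) (fun _ => volForm) z v =
      Matrix.det (Matrix.of (Matrix.vecCons (diagField (eulerCoeff w) z) v)) :=
    volForm_apply _
  rw [h, Matrix.det_succ_row_zero]
  simp only [omegaZero, ContinuousAlternatingMap.sum_apply,
    ContinuousAlternatingMap.smul_apply, dzHat_apply]
  refine Finset.sum_congr rfl fun ρ _ => ?_
  simp [diagField, eulerCoeff, Matrix.submatrix, mul_assoc]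

theorem pullback_volForm (c : Fin 5 → ℂ) (z : Vec) :
    pullback (diag c) (fun _ => volForm) z = (∏ ρ, c ρ) • volForm := by
  ext v
  have h : (Matrix.of (diag c ∘ v) : Matrix (Fin 5) (Fin 5) ℂ) =
      Matrix.of fun i j => c j * (Matrix.of v) i j := by
    ext i j
    simp
  rw [ContinuousAlternatingMap.smul_apply, pullback,
    ContinuousAlternatingMap.compContinuousLinearMap_apply, volForm_apply, volForm_apply, h,
    Matrix.det_mul_row, smul_eq_mul]

theorem diag_diagField (c c' : Fin 5 → ℂ) (z : Vec) :
    diagField c' (diag c z) = diag c (diagField c' z) := by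
  ext ρ
  simp [diagField, mul_left_comm]

theorem pullback_interior {k : ℕ} (c c' : Fin 5 → ℂ) (ω : Form (k + 1)) (z : Vec) :
    pullback (diag c) (interior (diagField c') ω) z =
      interior (diagField c') (pullback (diag c) ω) z := by
  simp only [pullback, interior, diag_diagField,
    ContinuousAlternatingMap.curryLeft_compContinuousLinearMap]

theorem pullback_omegaZero (w : Fin 5 → ℕ) (c : Fin 5 → ℂ) (z : Vec) :
    pullback (diag c) (omegaZero w) z = (∏ ρ, c ρ) • omegaZero w z := by
  rw [omegaZero_eq, pullback_interior]
  simp only [interior, pullback_volForm]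
  rfl

theorem interior_interior {k : ℕ} (X : Vec → Vec) (ω : Form (k + 2)) (z : Vec) :
    interior X (interior X ω) z = 0 :=
  ContinuousAlternatingMap.curryLeft_same (ω z) (X z)

theorem interior_euler_omegaZero (w : Fin 5 → ℕ) (z : Vec) :
    interior (diagField (eulerCoeff w)) (omegaZero w) z = 0 := by
  rw [omegaZero_eq]
  generalize volForm = η
  exact interior_interior (k := 3) (diagField (eulerCoeff w)) (fun _ => η) z

theorem differentiable_omegaZero (w : Fin 5 → ℕ) : Differentiable ℂ (omegaZero w) := by
  unfold omegaZero
  fun_prop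

/-- Reduces Lie derivatives to scalars: a form scaled by the determinant under diagonal maps
contributes only the divergence `∑ c_ρ`. Both the volume form and `Ω_0` are of this kind. -/
theorem lieDeriv_smul {k : ℕ} (c : Fin 5 → ℂ) {ω : Form k} {g : Vec → ℂ} {z : Vec}
    (hω : ∀ c : Fin 5 → ℂ, pullback (diag c) ω z = (∏ ρ, c ρ) • ω z)
    (hg : DifferentiableAt ℂ g z) :
    lieDeriv c (fun y => g y • ω y) z =
      (fderiv ℂ g z (diagField c z) + (∑ ρ, c ρ) * g z) • ω z := by
  have h : ∀ t, pullback (diagFlow c t) (fun y => g y • ω y) z =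
      (g (diagFlow c t z) * Complex.exp (t * ∑ ρ, c ρ)) • ω z := by
    intro t
    rw [Finset.mul_sum, Complex.exp_sum, mul_smul, ← hω]
    rfl
  simp only [lieDeriv, h]
  have h₁ : HasDerivAt (fun t => diagFlow c t z) (diagField c z) 0 := by
    simpa [diagFlow_zero] using (diagFlow_isFlow c z).2 0
  have h₂ : HasFDerivAt g (fderiv ℂ g z) (diagFlow c 0 z) := by
    simpa [diagFlow_zero] using hg.hasFDerivAt
  have h₃ : HasDerivAt (fun t : ℂ => Complex.exp (t * ∑ ρ, c ρ)) (∑ ρ, c ρ) 0 := by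
    simpa using ((hasDerivAt_id (0 : ℂ)).mul_const (∑ ρ, c ρ)).cexp
  convert! (((h₂.comp_hasDerivAt 0 h₁).mul h₃).smul_const (ω z)).deriv using 2
  simp [diagFlow_zero, mul_comm]

theorem form_six_eq_zero (η : Vec [⋀^Fin 6]→L[ℂ] ℂ) : η = 0 := by
  ext v
  refine AlternatingMap.map_linearDependent η.toAlternatingMap v fun h => ?_
  have := h.fintype_card_le_finrank
  simp at this

/-- `d(g Ω_0) = (E g + (w_1 + ... + w_5) g) dz_1 ∧ ... ∧ dz_5`. -/
theorem extDeriv_smul_omegaZero (w : Fin 5 → ℕ) {g : Vec → ℂ} {z : Vec}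
    (hg : DifferentiableAt ℂ g z) :
    extDeriv (fun y => g y • omegaZero w y) z =
      (fderiv ℂ g z (diagField (eulerCoeff w) z) + (∑ ρ, eulerCoeff w ρ) * g z) • volForm := by
  -- Cartan's formula for `g` times the volume form: `d` of it vanishes for degree reasons, and its
  -- contraction with `E` is `g Ω_0`.
  have h := lieDeriv_eq_extDeriv_interior (eulerCoeff w) (ω := fun y => g y • volForm) (z := z)
    (hg.smul_const _)
  rw [lieDeriv_smul _ (ω := fun _ => volForm) (fun c => pullback_volForm c z) hg] at h
  rw [h, show interior (diagField (eulerCoeff w)) (extDeriv fun y => g y • volForm) z = 0 by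
    rw [interior, form_six_eq_zero (extDeriv _ z)]; rfl, zero_add, omegaZero_eq]
  rfl

/-! ### Analytic functions on an open set and linear vector fields -/

section Analytic

variable {X : Type*} [NormedAddCommGroup X] [NormedSpace ℂ X]

/-- The analytic functions on an open set, extended by zero. -/
def analyticFunctions (S : Opens X) : Submodule ℂ (X → ℂ) where
  carrier := {g | AnalyticOnNhd ℂ g S ∧ ∀ p ∉ S, g p = 0}
  add_mem' := fun hg hh =>
    ⟨hg.1.add hh.1, fun p hp => by simp [hg.2 p hp, hh.2 p hp]⟩
  zero_mem' := ⟨analyticOnNhd_const, fun _ _ => rfl⟩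
  smul_mem' := fun c g hg =>
    ⟨(analyticOnNhd_const (v := c)).smul hg.1, fun p hp => by simp [hg.2 p hp]⟩

/-- The type of analytic functions on an open set, extended by zero. -/
def AnalyticFun (S : Opens X) : Type _ := analyticFunctions S

namespace AnalyticFun

variable {S : Opens X}

instance : AddCommGroup (AnalyticFun S) := inferInstanceAs (AddCommGroup (analyticFunctions S))

instance : Module ℂ (AnalyticFun S) := inferInstanceAs (Module ℂ (analyticFunctions S))

/-- The underlying function. -/
def toFun (g : AnalyticFun S) : X → ℂ := g.1

instance : CoeFun (AnalyticFun S) fun _ => X → ℂ := ⟨toFun⟩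

theorem analyticOnNhd (g : AnalyticFun S) : AnalyticOnNhd ℂ g S := g.2.1

theorem apply_of_notMem (g : AnalyticFun S) {p : X} (hp : p ∉ S) : g p = 0 := g.2.2 p hp

theorem differentiableAt (g : AnalyticFun S) {p : X} (hp : p ∈ S) : DifferentiableAt ℂ g p :=
  (g.analyticOnNhd p hp).differentiableAt

theorem add_apply (g h : AnalyticFun S) (p : X) : (g + h) p = g p + h p := rfl

theorem sub_apply (g h : AnalyticFun S) (p : X) : (g - h) p = g p - h p := rfl

theorem smul_apply (c : ℂ) (g : AnalyticFun S) (p : X) : (c • g) p = c * g p := rfl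

theorem zero_apply (p : X) : (0 : AnalyticFun S) p = 0 := rfl

/-- Extension by zero makes agreement on `S` an equality of elements, so operator identities checked
on `S` hold in the endomorphism ring. -/
theorem ext_of_mem {g h : AnalyticFun S} (hgh : ∀ p ∈ S, g p = h p) : g = h := by
  refine Subtype.ext (funext fun p => ?_)
  by_cases hp : p ∈ S
  · exact hgh p hp
  · exact (g.apply_of_notMem hp).trans (h.apply_of_notMem hp).symm

end AnalyticFun

/-- The restriction of a function analytic on `S`. -/
def restrictAnalytic (S : Opens X) (g : X → ℂ) (hg : AnalyticOnNhd ℂ g (S : Set X)) :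
    AnalyticFun S :=
  ⟨(S : Set X).indicator g, by
    refine ⟨fun p hp => (hg p hp).congr ?_, fun p hp => Set.indicator_of_notMem hp g⟩
    filter_upwards [S.isOpen.mem_nhds hp] with q hq
    exact (Set.indicator_of_mem hq g).symm⟩

theorem restrictAnalytic_apply {S : Opens X} {g : X → ℂ}
    (hg : AnalyticOnNhd ℂ g (S : Set X)) {p : X} (hp : p ∈ S) : (restrictAnalytic S g hg) p = g p :=
  Set.indicator_of_mem (s := (S : Set X)) hp g

theorem AnalyticFun.analyticOnNhd_fderiv_apply {S : Opens X} (g : AnalyticFun S)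
    (L : X →L[ℂ] X) : AnalyticOnNhd ℂ (fun p => fderiv ℂ g p (L p)) S := fun p hp =>
  (ContinuousLinearMap.analyticAt_bilinear (.id ℂ (X →L[ℂ] ℂ)) (fderiv ℂ g p, L p)).comp₂
    (g.analyticOnNhd p hp).fderiv (L.analyticAt p)

/-- The derivation along the linear vector field `L`. -/
def lieOp (S : Opens X) (L : X →L[ℂ] X) : Module.End ℂ (AnalyticFun S) where
  toFun g := restrictAnalytic S (fun p => fderiv ℂ g p (L p)) (g.analyticOnNhd_fderiv_apply L)
  map_add' g h := AnalyticFun.ext_of_mem fun p hp => by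
    rw [AnalyticFun.add_apply,
      restrictAnalytic_apply (AnalyticFun.analyticOnNhd_fderiv_apply _ L) hp,
      restrictAnalytic_apply (AnalyticFun.analyticOnNhd_fderiv_apply _ L) hp,
      restrictAnalytic_apply (AnalyticFun.analyticOnNhd_fderiv_apply _ L) hp]
    change fderiv ℂ (⇑g + ⇑h) p (L p) = _
    rw [fderiv_add (g.differentiableAt hp) (h.differentiableAt hp)]
    rfl
  map_smul' c g := AnalyticFun.ext_of_mem fun p hp => by
    rw [AnalyticFun.smul_apply,
      restrictAnalytic_apply (AnalyticFun.analyticOnNhd_fderiv_apply _ L) hp,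
      restrictAnalytic_apply (AnalyticFun.analyticOnNhd_fderiv_apply _ L) hp]
    change fderiv ℂ (c • ⇑g) p (L p) = _
    rw [fderiv_const_smul (g.differentiableAt hp)]
    rfl

theorem lieOp_apply {S : Opens X} (L : X →L[ℂ] X) (g : AnalyticFun S) {p : X}
    (hp : p ∈ S) : (lieOp S L g) p = fderiv ℂ g p (L p) :=
  restrictAnalytic_apply (g.analyticOnNhd_fderiv_apply L) hp

theorem lieOp_lieOp_apply {S : Opens X} (L M : X →L[ℂ] X) (g : AnalyticFun S) {p : X}
    (hp : p ∈ S) : (lieOp S L (lieOp S M g)) p =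
      fderiv ℂ (fderiv ℂ g) p (L p) (M p) + fderiv ℂ g p (M (L p)) := by
  rw [lieOp_apply L _ hp]
  have h : ⇑(lieOp S M g) =ᶠ[𝓝 p] fun q => fderiv ℂ g q (M q) := by
    filter_upwards [S.isOpen.mem_nhds hp] with q hq using lieOp_apply M g hq
  rw [h.fderiv_eq,
    fderiv_clm_apply (g.analyticOnNhd p hp).fderiv.differentiableAt M.differentiableAt]
  simp [add_comm]

/-- The second-order parts agree by symmetry of the second derivative, and the first-order parts
differ by the commutator of the linear maps. -/
theorem lieOp_commute (S : Opens X) {L M : X →L[ℂ] X} (h : ∀ p, L (M p) = M (L p)) :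
    Commute (lieOp S L) (lieOp S M) := by
  refine LinearMap.ext fun g => AnalyticFun.ext_of_mem fun p hp => ?_
  rw [Module.End.mul_apply, Module.End.mul_apply, lieOp_lieOp_apply _ _ _ hp,
    lieOp_lieOp_apply _ _ _ hp, h]
  have hs : IsSymmSndFDerivAt ℂ g p :=
    (g.analyticOnNhd p hp).contDiffAt.isSymmSndFDerivAt (n := ⊤) le_top
  rw [hs.eq]

/-- Multiplication by an analytic function. -/
def mulOp (S : Opens X) (h : X → ℂ) (hh : AnalyticOnNhd ℂ h (S : Set X)) :
    Module.End ℂ (AnalyticFun S) where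
  toFun g := ⟨h * g, ⟨hh.mul (g.analyticOnNhd), fun p hp => by simp [g.apply_of_notMem hp]⟩⟩
  map_add' g g' := Subtype.ext (mul_add h g g')
  map_smul' c g := Subtype.ext (mul_smul_comm c h g)

theorem mulOp_apply {S : Opens X} {h : X → ℂ} (hh : AnalyticOnNhd ℂ h (S : Set X))
    (g : AnalyticFun S) (p : X) : (mulOp S h hh g) p = h p * g p := rfl

theorem lieOp_mulOp_commute {S : Opens X} {L : X →L[ℂ] X} {h : X → ℂ}
    (hh : AnalyticOnNhd ℂ h (S : Set X))
    (hL : ∀ p ∈ S, fderiv ℂ h p (L p) = 0) : Commute (lieOp S L) (mulOp S h hh) := by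
  refine LinearMap.ext fun g => AnalyticFun.ext_of_mem fun p hp => ?_
  rw [Module.End.mul_apply, Module.End.mul_apply, lieOp_apply _ _ hp, mulOp_apply,
    lieOp_apply _ _ hp]
  change fderiv ℂ (h * ⇑g) p (L p) = _
  rw [fderiv_mul (hh p hp).differentiableAt (g.differentiableAt hp)]
  simp [hL p hp]

end Analytic

/-- Telescoping expansion of a difference of products of noncommuting factors. -/
theorem sum_prod_take_mul_sub_mul_prod_drop {ι R : Type*} [Ring R] (A B : ι → R)
    (fs : List ι) :
    ∑ r : Fin fs.length, ((fs.take r).map B).prod * (B (fs.get r) - A (fs.get r)) *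
      ((fs.drop (r + 1)).map A).prod = (fs.map B).prod - (fs.map A).prod := by
  induction fs with
  | nil => simp
  | cons f fs ih =>
    have h : ∑ r : Fin (f :: fs).length, (((f :: fs).take r).map B).prod *
        (B ((f :: fs).get r) - A ((f :: fs).get r)) * (((f :: fs).drop (r + 1)).map A).prod =
        (B f - A f) * (fs.map A).prod + B f * ∑ r : Fin fs.length, ((fs.take r).map B).prod *
          (B (fs.get r) - A (fs.get r)) * ((fs.drop (r + 1)).map A).prod := by
      simp only [List.length_cons]
      rw [Fin.sum_univ_succ, Finset.mul_sum]
      simp [mul_assoc]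
    rw [h, ih]
    simp only [List.map_cons, List.prod_cons]
    noncomm_ring

/-! ### Operators on coefficient functions -/

/-- The linear vector field `∑_k s_k a_k ∂/∂a_k + ∑_ρ c_ρ z_ρ ∂/∂z_ρ`. -/
def scaling {N : ℕ} (s : Idx N → ℂ) (c : Fin 5 → ℂ) :
    (Idx N → ℂ) × Vec →L[ℂ] (Idx N → ℂ) × Vec :=
  (ContinuousLinearMap.pi fun k =>
    s k • ContinuousLinearMap.proj (R := ℂ) (φ := fun _ => ℂ) k).prodMap (diag c)

theorem scaling_apply {N : ℕ} (s : Idx N → ℂ) (c : Fin 5 → ℂ) (p : (Idx N → ℂ) × Vec) :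
    scaling s c p = (s * p.1, diagField c p.2) := by
  ext <;> simp [scaling, diagField]

theorem lieOp_scaling_commute {N : ℕ} (S : Opens ((Idx N → ℂ) × Vec)) (s s' : Idx N → ℂ)
    (c c' : Fin 5 → ℂ) : Commute (lieOp S (scaling s c)) (lieOp S (scaling s' c')) := by
  refine lieOp_commute S fun p => ?_
  ext <;> simp [scaling_apply, diagField, mul_left_comm]

section Operators

variable {N : ℕ} (w : Fin 5 → ℕ) (S : Opens ((Idx N → ℂ) × Vec))

/-- The action of `a_k ∂/∂a_k` on coefficients of `omegaZero`. -/
def thetaOp (k : Idx N) : Module.End ℂ (AnalyticFun S) :=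
  lieOp S (scaling (Pi.single k 1) 0)

/-- The action of the Lie derivative along `diagField c` on coefficients of `omegaZero`. -/
def lieDerivOp (c : Fin 5 → ℂ) : Module.End ℂ (AnalyticFun S) :=
  lieOp S (scaling 0 c) + (∑ ρ, c ρ) • 1

/-- The action of `factor` on coefficients of `omegaZero`. -/
def factorOp (f : Idx N × ℕ) : Module.End ℂ (AnalyticFun S) :=
  thetaOp S f.1 - (f.2 : ℂ) • 1

/-- The action of `lieFactor` on coefficients of `omegaZero`. -/
def lieFactorOp (f : Idx N × ℕ) : Module.End ℂ (AnalyticFun S) :=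
  factorOp S f + ∑ i, if f.1 = vertex i then lieDerivOp S (coordCoeff w i) else 0

/-- The action of `lieCofactor` on coefficients of `omegaZero`. -/
def lieCofactorOp (i : Fin 5) (fs : List (Idx N × ℕ)) : Module.End ℂ (AnalyticFun S) :=
  ∑ r : Fin fs.length, if (fs.get r).1 = vertex i then
    ((fs.take r).map (lieFactorOp w S)).prod * ((fs.drop (r + 1)).map (factorOp S)).prod else 0

variable {S}

/-- This and the next lemmas share one hypothesis: whatever commutes with all derivations along
diagonal fields commutes with every operator built from them. -/
theorem commute_lieDerivOp {T : Module.End ℂ (AnalyticFun S)}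
    (hT : ∀ s c, Commute (lieOp S (scaling s c)) T) (c : Fin 5 → ℂ) :
    Commute (lieDerivOp S c) T :=
  (hT 0 c).add_left ((Commute.one_left T).smul_left _)

theorem commute_factorOp {T : Module.End ℂ (AnalyticFun S)}
    (hT : ∀ s c, Commute (lieOp S (scaling s c)) T) (f : Idx N × ℕ) :
    Commute (factorOp S f) T :=
  (hT _ _).sub_left ((Commute.one_left T).smul_left _)

theorem commute_lieFactorOp {T : Module.End ℂ (AnalyticFun S)}
    (hT : ∀ s c, Commute (lieOp S (scaling s c)) T) (f : Idx N × ℕ) :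
    Commute (lieFactorOp w S f) T := by
  refine (commute_factorOp hT f).add_left (Commute.sum_left _ _ _ fun i _ => ?_)
  split_ifs
  · exact commute_lieDerivOp hT _
  · exact Commute.zero_left T

theorem commute_prod_factorOp {T : Module.End ℂ (AnalyticFun S)}
    (hT : ∀ s c, Commute (lieOp S (scaling s c)) T) (fs : List (Idx N × ℕ)) :
    Commute (fs.map (factorOp S)).prod T := by
  refine Commute.list_prod_left _ _ fun A hA => ?_
  obtain ⟨f, -, rfl⟩ := List.mem_map.1 hA
  exact commute_factorOp hT f

theorem commute_prod_lieFactorOp {T : Module.End ℂ (AnalyticFun S)}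
    (hT : ∀ s c, Commute (lieOp S (scaling s c)) T) (fs : List (Idx N × ℕ)) :
    Commute (fs.map (lieFactorOp w S)).prod T := by
  refine Commute.list_prod_left _ _ fun A hA => ?_
  obtain ⟨f, -, rfl⟩ := List.mem_map.1 hA
  exact commute_lieFactorOp w hT f

theorem commute_lieCofactorOp {T : Module.End ℂ (AnalyticFun S)}
    (hT : ∀ s c, Commute (lieOp S (scaling s c)) T) (i : Fin 5) (fs : List (Idx N × ℕ)) :
    Commute (lieCofactorOp w S i fs) T := by
  refine Commute.sum_left _ _ _ fun r _ => ?_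
  split_ifs
  · exact (commute_prod_lieFactorOp w hT _).mul_left (commute_prod_factorOp hT _)
  · exact Commute.zero_left T

theorem lieOp_commute_lieDerivOp (s : Idx N → ℂ) (c c' : Fin 5 → ℂ) :
    Commute (lieOp S (scaling s c)) (lieDerivOp S c') :=
  (commute_lieDerivOp (fun s' c'' => lieOp_scaling_commute S s' s c'' c) c').symm

theorem lieOp_commute_lieFactorOp (s : Idx N → ℂ) (c : Fin 5 → ℂ) (f : Idx N × ℕ) :
    Commute (lieOp S (scaling s c)) (lieFactorOp w S f) :=
  (commute_lieFactorOp w (fun s' c' => lieOp_scaling_commute S s' s c' c) f).symm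

/-- In the telescoping sum the difference of the two kinds of factor is a Lie operator standing
between prefix and suffix; commuting it past the prefix leaves the cofactor. -/
theorem sum_lieDerivOp_mul_lieCofactorOp (fs : List (Idx N × ℕ)) :
    ∑ i, lieDerivOp S (coordCoeff w i) * lieCofactorOp w S i fs =
      (fs.map (lieFactorOp w S)).prod - (fs.map (factorOp S)).prod := by
  rw [← sum_prod_take_mul_sub_mul_prod_drop]
  simp only [lieCofactorOp, Finset.mul_sum]
  rw [Finset.sum_comm]
  refine Finset.sum_congr rfl fun r _ => ?_
  rw [lieFactorOp, add_sub_cancel_left, Finset.mul_sum, Finset.sum_mul]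
  refine Finset.sum_congr rfl fun i _ => ?_
  split_ifs
  · rw [← mul_assoc, (commute_prod_lieFactorOp w (fun s c =>
      lieOp_commute_lieDerivOp s c _) _).eq]
  · simp

end Operators

/-! ### Families of multiples of `omegaZero` -/

section Coefficients

variable {N : ℕ} {w : Fin 5 → ℕ} {S : Opens ((Idx N → ℂ) × Vec)}

variable (w) in
/-- The family `F` is `g Ω_0` on `S`. -/
def IsCoeff (F : Family N 4) (g : AnalyticFun S) : Prop :=
  ∀ p ∈ S, F p.1 p.2 = g p • omegaZero w p.2

theorem lieDeriv_congr {k : ℕ} (c : Fin 5 → ℂ) {ω ω' : Form k} {z : Vec} (h : ω =ᶠ[𝓝 z] ω') :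
    lieDeriv c ω z = lieDeriv c ω' z := by
  refine EventuallyEq.deriv_eq ?_
  have h₁ : Tendsto (fun t => diagFlow c t z) (𝓝 0) (𝓝 z) := by
    simpa [diagFlow_zero] using ((diagFlow_isFlow c z).2 0).continuousAt.tendsto
  filter_upwards [h₁.eventually h] with t ht
  simp only [pullback, ht]

theorem IsCoeff.eventuallyEq_left {F : Family N 4} {g : AnalyticFun S}
    (h : IsCoeff w F g) {p : (Idx N → ℂ) × Vec} (hp : p ∈ S) :
    (fun b => F b p.2) =ᶠ[𝓝 p.1]
      fun b => g (b, p.2) • omegaZero w p.2 := by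
  have : ∀ᶠ b in 𝓝 p.1, (b, p.2) ∈ S :=
    (Continuous.prodMk_left p.2).continuousAt.eventually (S.isOpen.mem_nhds hp)
  filter_upwards [this] with b hb using h (b, p.2) hb

theorem IsCoeff.eventuallyEq_right {F : Family N 4} {g : AnalyticFun S}
    (h : IsCoeff w F g) {p : (Idx N → ℂ) × Vec} (hp : p ∈ S) :
    F p.1 =ᶠ[𝓝 p.2] fun z => g (p.1, z) • omegaZero w z := by
  have : ∀ᶠ z in 𝓝 p.2, (p.1, z) ∈ S :=
    (Continuous.prodMk_right p.1).continuousAt.eventually (S.isOpen.mem_nhds hp)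
  filter_upwards [this] with z hz using h (p.1, z) hz

theorem hasFDerivAt_slice_left (g : AnalyticFun S) {p : (Idx N → ℂ) × Vec} (hp : p ∈ S) :
    HasFDerivAt (fun b => g (b, p.2))
      (fderiv ℂ g p ∘L ContinuousLinearMap.inl ℂ _ _) p.1 :=
  HasFDerivAt.comp (g := g) p.1
    (g.differentiableAt hp).hasFDerivAt (hasFDerivAt_prodMk_left p.1 p.2)

theorem hasFDerivAt_slice_right (g : AnalyticFun S) {p : (Idx N → ℂ) × Vec} (hp : p ∈ S) :
    HasFDerivAt (fun z => g (p.1, z))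
      (fderiv ℂ g p ∘L ContinuousLinearMap.inr ℂ _ _) p.2 :=
  HasFDerivAt.comp (g := g) p.2
    (g.differentiableAt hp).hasFDerivAt (hasFDerivAt_prodMk_right p.1 p.2)

theorem IsCoeff.theta {F : Family N 4} {g : AnalyticFun S} (h : IsCoeff w F g)
    (k : Idx N) : IsCoeff w (theta k F) (thetaOp S k g) := by
  intro p hp
  have h₁ : fderiv ℂ (fun b => g (b, p.2) • omegaZero w p.2) p.1 = _ :=
    ((hasFDerivAt_slice_left g hp).smul_const (omegaZero w p.2)).fderiv
  rw [BetaTerm.theta, (h.eventuallyEq_left hp).fderiv_eq, h₁, thetaOp, lieOp_apply _ _ hp]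
  -- `Ω_0` does not depend on `a`, so only the coefficient is differentiated.
  have : scaling (Pi.single k 1) 0 p = p.1 k • ((Pi.single k 1, 0) : (Idx N → ℂ) × Vec) := by
    rw [scaling_apply]
    ext j
    · by_cases hj : j = k
      · subst hj; simp
      · simp [hj]
    · simp [diagField]
  rw [this, map_smul]
  simp [smul_smul]

theorem IsCoeff.lieDeriv {F : Family N 4} {g : AnalyticFun S} (h : IsCoeff w F g)
    (c : Fin 5 → ℂ) : IsCoeff w (fun a => lieDeriv c (F a)) (lieDerivOp S c g) := by
  intro p hp
  have h₁ := hasFDerivAt_slice_right g hp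
  change BetaTerm.lieDeriv c (F p.1) p.2 = _
  rw [lieDeriv_congr c (h.eventuallyEq_right hp),
    lieDeriv_smul c (fun c => pullback_omegaZero w c p.2) h₁.differentiableAt, h₁.fderiv]
  congr 1
  change _ = (lieOp S (scaling 0 c) g ) p +
    (∑ ρ, c ρ) * g p
  rw [lieOp_apply _ _ hp, scaling_apply]
  simp

theorem IsCoeff.add {F G : Family N 4} {g h : AnalyticFun S} (hF : IsCoeff w F g)
    (hG : IsCoeff w G h) : IsCoeff w (F + G) (g + h) := fun p hp => by
  rw [AnalyticFun.add_apply]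
  exact (congrArg₂ (· + ·) (hF p hp) (hG p hp)).trans (add_smul (g p) (h p) _).symm

theorem IsCoeff.sub {F G : Family N 4} {g h : AnalyticFun S} (hF : IsCoeff w F g)
    (hG : IsCoeff w G h) : IsCoeff w (F - G) (g - h) := fun p hp => by
  rw [AnalyticFun.sub_apply]
  exact (congrArg₂ (· - ·) (hF p hp) (hG p hp)).trans (sub_smul (g p) (h p) _).symm

theorem IsCoeff.smul {F : Family N 4} {g : AnalyticFun S} (hF : IsCoeff w F g)
    (c : ℂ) : IsCoeff w (c • F) (c • g) := fun p hp => by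
  rw [AnalyticFun.smul_apply]
  exact (congrArg (c • ·) (hF p hp)).trans (mul_smul c (g p) _).symm

theorem IsCoeff.zero : IsCoeff w (0 : Family N 4) (0 : AnalyticFun S) := fun p _ =>
  (zero_smul ℂ (omegaZero w p.2)).symm

theorem IsCoeff.neg {F : Family N 4} {g : AnalyticFun S} (hF : IsCoeff w F g) :
    IsCoeff w (-F) (-g) := by
  simpa using IsCoeff.zero.sub hF

theorem IsCoeff.sum {ι : Type*} (s : Finset ι) {F : ι → Family N 4}
    {g : ι → AnalyticFun S} (h : ∀ i ∈ s, IsCoeff w (F i) (g i)) :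
    IsCoeff w (∑ i ∈ s, F i) (∑ i ∈ s, g i) := by
  induction s using Finset.cons_induction with
  | empty => simpa using IsCoeff.zero
  | cons i s hi ih =>
    rw [Finset.sum_cons, Finset.sum_cons]
    exact (h i (by simp)).add (ih fun j hj => h j (by simp [hj]))

theorem IsCoeff.factor {F : Family N 4} {g : AnalyticFun S} (h : IsCoeff w F g)
    (f : Idx N × ℕ) : IsCoeff w (factor f F) (factorOp S f g) :=
  (h.theta f.1).sub (h.smul _)

theorem IsCoeff.lieFactor {F : Family N 4} {g : AnalyticFun S} (h : IsCoeff w F g)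
    (f : Idx N × ℕ) : IsCoeff w (lieFactor w f F) (lieFactorOp w S f g) := by
  rw [lieFactorOp, LinearMap.add_apply, LinearMap.sum_apply]
  refine (h.factor f).add (IsCoeff.sum _ fun i _ => ?_)
  split_ifs
  · exact h.lieDeriv _
  · exact IsCoeff.zero

theorem IsCoeff.compose {T : Idx N × ℕ → Family N 4 → Family N 4}
    {T' : Idx N × ℕ → Module.End ℂ (AnalyticFun S)}
    (hT : ∀ f F g, IsCoeff w F g → IsCoeff w (T f F) (T' f g)) (fs : List (Idx N × ℕ))
    {F : Family N 4} {g : AnalyticFun S} (h : IsCoeff w F g) :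
    IsCoeff w (compose T fs F) ((fs.map T').prod g) := by
  induction fs with
  | nil => exact h
  | cons f fs ih => exact hT f _ _ ih

theorem IsCoeff.lieCofactor {F : Family N 4} {g : AnalyticFun S} (h : IsCoeff w F g)
    (i : Fin 5) (fs : List (Idx N × ℕ)) :
    IsCoeff w (lieCofactor w i fs F) (lieCofactorOp w S i fs g) := by
  rw [lieCofactorOp, LinearMap.sum_apply]
  refine IsCoeff.sum _ fun r _ => ?_
  split_ifs
  · exact (h.compose (fun f _ _ h => h.factor f) _).compose (fun f _ _ h => h.lieFactor f) _
  · exact IsCoeff.zero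

end Coefficients

/-! ### Exponents of the defining polynomial -/

section Exponents

variable {w : Fin 5 → ℕ}

theorem mul_deg_div (hfermat : ∀ ρ, w ρ ∣ deg w) (ρ : Fin 5) :
    (w ρ : ℤ) * ((deg w / w ρ : ℕ) : ℤ) = deg w := by
  exact_mod_cast Nat.mul_div_cancel' (hfermat ρ)

/-- The vertices give the Fermat monomials `z_σ^{d/w_σ}`. For the last vertex `w_5 = 1` enters
through `d - 1 = w_1 + ... + w_4`. -/
theorem pairing_dualVertex_ray (hlast : w (Fin.last 4) = 1)
    (hfermat : ∀ ρ, w ρ ∣ deg w) (σ ρ : Fin 5) :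
    pairing (dualVertex w σ) (ray w ρ) + 1 = if ρ = σ then ((deg w / w ρ : ℕ) : ℤ) else 0 := by
  have hd : (deg w : ℤ) = ∑ j : Fin 4, (w j.castSucc : ℤ) + 1 := by
    rw [deg, Fin.sum_univ_castSucc, hlast]
    push_cast
    rfl
  have hq := mul_deg_div hfermat
  have hq' : ((deg w / w (Fin.last 4) : ℕ) : ℤ) = deg w := by simp [hlast, -Fin.reduceLast]
  simp only [pairing, ray]
  cases σ using Fin.lastCases with
  | last =>
    have h : ∀ j : Fin 4, dualVertex w (Fin.last 4) j *
        ((if ρ = j.castSucc then ((deg w / w ρ : ℕ) : ℤ) else 0) - 1) =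
        (w j.castSucc : ℤ) - if ρ = j.castSucc then (deg w : ℤ) else 0 := by
      intro j
      rw [dualVertex, if_pos rfl]
      split_ifs with hj
      · subst hj
        linear_combination -hq j.castSucc
      · ring
    rw [Finset.sum_congr rfl fun j _ => h j, Finset.sum_sub_distrib]
    cases ρ using Fin.lastCases with
    | last =>
      simp only [fun j : Fin 4 => (Fin.castSucc_lt_last j).ne', if_false, Finset.sum_const_zero,
        if_true, hq', hd]
      ring
    | cast i =>
      simp only [Fin.castSucc_inj, Finset.sum_ite_eq, Finset.mem_univ, if_true,
        (Fin.castSucc_lt_last i).ne, if_false, hd]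
      ring
  | cast i =>
    simp only [dualVertex, (Fin.castSucc_lt_last i).ne, if_false, Fin.castSucc_inj, ite_mul,
      one_mul, zero_mul, Finset.sum_ite_eq, Finset.mem_univ, if_true]
    ring

/-- Pairing at least `-1` with a ray is a half-space condition, so it passes from the vertices to
their convex hull. -/
theorem pairing_ray_add_one_nonneg (hlast : w (Fin.last 4) = 1)
    (hfermat : ∀ ρ, w ρ ∣ deg w) {v : Fin 4 → ℤ} (hv : v ∈ dualPoints w) (ρ : Fin 5) :
    0 ≤ pairing v (ray w ρ) + 1 := by
  have h : convexHull ℝ (Set.range fun σ j => (dualVertex w σ j : ℝ)) ⊆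
      {x : Fin 4 → ℝ | -1 ≤ ∑ j, x j * (ray w ρ j : ℝ)} := by
    refine convexHull_min ?_ (convex_halfSpace_ge ?_ _)
    · rintro _ ⟨σ, rfl⟩
      have := pairing_dualVertex_ray hlast hfermat σ ρ
      have h₀ : 0 ≤ pairing (dualVertex w σ) (ray w ρ) + 1 := by
        rw [this]
        split_ifs <;> positivity
      simp only [Set.mem_ofPred_eq]
      have h₁ : (-1 : ℤ) ≤ ∑ j, dualVertex w σ j * ray w ρ j := by
        simp only [pairing] at h₀
        linarith
      exact_mod_cast h₁
    · exact ⟨fun x y => by simp [add_mul, Finset.sum_add_distrib],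
        fun c x => by simp [Finset.mul_sum, mul_assoc]⟩
  have h₁ := h hv
  simp only [Set.mem_ofPred_eq] at h₁
  have h₂ : (-1 : ℤ) ≤ ∑ j, v j * ray w ρ j := by exact_mod_cast h₁
  simp only [pairing]
  linarith

/-- Because `∑ w_ρ v_ρ = 0`, every monomial has weighted degree `d`. -/
theorem sum_mul_pairing_ray (hfermat : ∀ ρ, w ρ ∣ deg w) (v : Fin 4 → ℤ) :
    ∑ ρ, (w ρ : ℤ) * (pairing v (ray w ρ) + 1) = deg w := by
  have h : ∀ j : Fin 4, ∑ ρ, (w ρ : ℤ) * ray w ρ j = 0 := by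
    intro j
    simp only [ray, mul_sub, Finset.sum_sub_distrib, mul_ite, mul_zero, Finset.sum_ite_eq',
      Finset.mem_univ, if_true, mul_deg_div hfermat, mul_one]
    rw [deg]
    push_cast
    ring
  have h₁ : ∑ ρ, (w ρ : ℤ) * pairing v (ray w ρ) = 0 := by
    simp only [pairing, Finset.mul_sum]
    rw [Finset.sum_comm]
    refine Finset.sum_eq_zero fun j _ => ?_
    have := congrArg (v j * ·) (h j)
    simp only [Finset.mul_sum, mul_zero] at this
    rw [← this]
    exact Finset.sum_congr rfl fun ρ _ => by ring
  simp [mul_add, Finset.sum_add_distrib, h₁, deg]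

/-- The exponent of `z_ρ` in the monomial labelled by `k`. -/
def expo (w : Fin 5 → ℕ) {N : ℕ} (u : Fin N → Fin 4 → ℤ) (k : Idx N) (ρ : Fin 5) : ℕ :=
  (pairing (point w u k) (ray w ρ) + 1).toNat

variable {N : ℕ} {u : Fin N → Fin 4 → ℤ}

theorem coe_expo (hlast : w (Fin.last 4) = 1)
    (hfermat : ∀ ρ, w ρ ∣ deg w) (hu : IsEnumeration w u) (k : Idx N) (ρ : Fin 5) :
    (expo w u k ρ : ℤ) = pairing (point w u k) (ray w ρ) + 1 := by
  refine Int.toNat_of_nonneg ?_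
  match k with
  | none => simp [point, pairing]
  | some (Sum.inl σ) =>
    rw [point, pairing_dualVertex_ray hlast hfermat]
    split_ifs <;> positivity
  | some (Sum.inr k) =>
    have : u k ∈ Set.range u := ⟨k, rfl⟩
    rw [hu.2] at this
    exact pairing_ray_add_one_nonneg hlast hfermat this.1 ρ

end Exponents

/-! ### Branches of the logarithm -/

section LogBranch

variable {N : ℕ} {U : Set (Idx N → ℂ)} {lam : Fin 5 → (Idx N → ℂ) → ℂ}

theorem analyticAt_coord {ι : Type*} [Fintype ι] (k : ι) (a : ι → ℂ) :
    AnalyticAt ℂ (fun b : ι → ℂ => b k) a :=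
  (ContinuousLinearMap.proj (R := ℂ) (φ := fun _ : ι => ℂ) k).analyticAt a

/-- Analyticity in several variables is read off from the principal logarithm: near `a` the branch
is a constant plus the logarithm of a ratio normalized to be `1` at `a`. Continuity keeps the
imaginary part of the increment within `π`, where `log` inverts `exp`. -/
theorem IsLogBranch.analyticAt (hlam : IsLogBranch U lam) (hU : IsOpen U)
    (hU0 : ∀ a ∈ U, ∀ k, a k ≠ 0) {a : Idx N → ℂ} (ha : a ∈ U) (ρ : Fin 5) :
    AnalyticAt ℂ (lam ρ) a := by
  have hcont : ContinuousAt (fun b => lam ρ b - lam ρ a) a :=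
    (((hlam ρ).1.differentiableAt (hU.mem_nhds ha)).continuousAt).sub continuousAt_const
  have hsmall : ∀ᶠ b in 𝓝 a, ‖lam ρ b - lam ρ a‖ < Real.pi := by
    refine hcont.norm.eventually (gt_mem_nhds ?_)
    simpa using Real.pi_pos
  have hlog : lam ρ =ᶠ[𝓝 a] fun b => lam ρ a +
      Complex.log ((b origin / b (vertex ρ)) / (a origin / a (vertex ρ))) := by
    filter_upwards [hsmall, hU.mem_nhds ha] with b hb hbU
    have hre := abs_lt.1 ((Complex.abs_im_le_norm _).trans_lt hb)
    rw [← (hlam ρ).2 b hbU, ← (hlam ρ).2 a ha, ← Complex.exp_sub,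
      Complex.log_exp hre.1 hre.2.le]
    ring
  refine AnalyticAt.congr ?_ hlog.symm
  have h₁ : a origin / a (vertex ρ) ≠ 0 := div_ne_zero (hU0 a ha _) (hU0 a ha _)
  refine analyticAt_const.add (AnalyticAt.clog ?_ ?_)
  · exact ((analyticAt_coord _ _).div (analyticAt_coord _ _) (hU0 a ha _)).div analyticAt_const h₁
  · rw [div_self h₁]
    exact Complex.one_mem_slitPlane

theorem hasDerivAt_line {E : Type*} [NormedAddCommGroup E] [NormedSpace ℂ E] (p v : E) :
    HasDerivAt (fun t : ℂ => p + t • v) v 0 := by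
  simpa using ((hasDerivAt_id (0 : ℂ)).smul_const v).const_add p

/-- Differentiate `exp (lam ρ) = a_0 / a_ρ`. With velocity `s * a` each `a_k` has logarithmic
derivative `s k`, so the choice of branch drops out. -/
theorem IsLogBranch.hasDerivAt_line (hlam : IsLogBranch U lam) (hU : IsOpen U)
    (hU0 : ∀ a ∈ U, ∀ k, a k ≠ 0) {a : Idx N → ℂ} (ha : a ∈ U) (s : Idx N → ℂ) (ρ : Fin 5) :
    HasDerivAt (fun t : ℂ => lam ρ (a + t • (s * a))) (s origin - s (vertex ρ)) 0 := by
  have hline := BetaTerm.hasDerivAt_line a (s * a)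
  have h₀ : a + (0 : ℂ) • (s * a) = a := by simp
  have hd : DifferentiableAt ℂ (lam ρ) (a + (0 : ℂ) • (s * a)) := by
    rw [h₀]
    exact (hlam ρ).1.differentiableAt (hU.mem_nhds ha)
  obtain ⟨x, hx⟩ : ∃ x, HasDerivAt (fun t : ℂ => lam ρ (a + t • (s * a))) x 0 :=
    ⟨_, hd.hasFDerivAt.comp_hasDerivAt 0 hline⟩
  have hk : ∀ k, HasDerivAt (fun t : ℂ => (a + t • (s * a)) k) (s k * a k) 0 := fun k =>
    (hasDerivAt_pi.1 hline) k
  have hU' : ∀ᶠ t in 𝓝 (0 : ℂ), a + t • (s * a) ∈ U :=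
    hline.continuousAt.eventually (by simpa using hU.mem_nhds ha)
  have h₁ := hx.cexp
  have hρ : (a + (0 : ℂ) • (s * a)) (vertex ρ) ≠ 0 := by rw [h₀]; exact hU0 a ha _
  have h₂ := ((hk origin).div (hk (vertex ρ)) hρ).congr_of_eventuallyEq
    (hU'.mono fun t ht => (hlam ρ).2 _ ht)
  have h₃ := h₁.unique h₂
  simp only [h₀, (hlam ρ).2 a ha] at h₃
  have ha₀ := hU0 a ha origin
  have haρ := hU0 a ha (vertex ρ)
  have : x = s origin - s (vertex ρ) := by
    field_simp at h₃
    linear_combination h₃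
  rwa [← this]

end LogBranch

/-! ### Logarithmic derivatives at the origin -/

/-- The function `f` has logarithmic derivative `x` at `0`. -/
def HasLogDerivAt (f : ℂ → ℂ) (x : ℂ) : Prop := HasDerivAt f (x * f 0) 0

namespace HasLogDerivAt

variable {f g : ℂ → ℂ} {x y : ℂ}

theorem mul (hf : HasLogDerivAt f x) (hg : HasLogDerivAt g y) :
    HasLogDerivAt (fun t => f t * g t) (x + y) := by
  have h := HasDerivAt.mul (x := (0 : ℂ)) hf hg
  unfold HasLogDerivAt
  convert! h using 1
  ring

theorem const (c : ℂ) : HasLogDerivAt (fun _ => c) 0 := by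
  unfold HasLogDerivAt
  simpa using hasDerivAt_const (0 : ℂ) c

theorem pow (hf : HasLogDerivAt f x) (n : ℕ) : HasLogDerivAt (fun t => f t ^ n) (n * x) := by
  induction n with
  | zero => simpa using const 1
  | succ n ih =>
    simp only [pow_succ]
    convert ih.mul hf using 1
    push_cast
    ring

theorem prod {ι : Type*} (s : Finset ι) {f : ι → ℂ → ℂ} {x : ι → ℂ}
    (h : ∀ i ∈ s, HasLogDerivAt (f i) (x i)) :
    HasLogDerivAt (fun t => ∏ i ∈ s, f i t) (∑ i ∈ s, x i) := by
  induction s using Finset.cons_induction with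
  | empty => simpa using const 1
  | cons i s hi ih =>
    simp only [Finset.prod_cons, Finset.sum_cons]
    exact (h i (by simp)).mul (ih fun j hj => h j (by simp [hj]))

theorem exp (hf : HasDerivAt f x 0) : HasLogDerivAt (fun t => Complex.exp (f t)) x := by
  unfold HasLogDerivAt
  rw [mul_comm]
  exact hf.cexp

end HasLogDerivAt

/-! ### Derivatives of the inverse of the defining polynomial -/

section Derivatives

variable (w : Fin 5 → ℕ) {N : ℕ} (u : Fin N → Fin 4 → ℤ) (lam : Fin 5 → (Idx N → ℂ) → ℂ)

/-- The factor by which the automorphism scales the `ρ`-th coordinate. -/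
def autCoeff (a : Idx N → ℂ) (ρ : Fin 5) : ℂ :=
  Complex.exp ((w ρ : ℂ) / (deg w : ℂ) * lam ρ a)

theorem autom_apply (a : Idx N → ℂ) (z : Vec) (ρ : Fin 5) :
    autom w lam a z ρ = autCoeff w lam a ρ * z ρ := by
  simp [autom, autCoeff]

/-- The term of the defining polynomial labelled by `k`, pulled back under the automorphism. -/
def termFun (k : Idx N) (p : (Idx N → ℂ) × Vec) : ℂ :=
  p.1 k * ∏ ρ, autom w lam p.1 p.2 ρ ^ expo w u k ρ

/-- Up to the factor `a_0` and the Jacobian, the pullback under the automorphism of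
`∏_k a_k^{n_k} (∂/∂a_k)^{n_k}` applied to the inverse of the defining polynomial. -/
def inverseDeriv (n : Idx N → ℕ) (p : (Idx N → ℂ) × Vec) : ℂ :=
  p.1 origin * (∏ ρ, autCoeff w lam p.1 ρ) *
    ((-1) ^ (∑ k, n k) * ((∑ k, n k).factorial : ℂ)) *
    (∏ k, termFun w u lam k p ^ n k) * (∑ k, termFun w u lam k p)⁻¹ ^ (∑ k, n k + 1)

variable {w u lam}

theorem cyPoly_autom (hlast : w (Fin.last 4) = 1) (hfermat : ∀ ρ, w ρ ∣ deg w)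
    (hu : IsEnumeration w u) (p : (Idx N → ℂ) × Vec) :
    cyPoly w u p.1 (autom w lam p.1 p.2) = ∑ k, termFun w u lam k p := by
  refine Finset.sum_congr rfl fun k _ => ?_
  rw [termFun]
  congr 1
  refine Finset.prod_congr rfl fun ρ _ => ?_
  rw [← coe_expo hlast hfermat hu, zpow_natCast]

variable {U : Set (Idx N → ℂ)}

theorem analyticAt_autCoeff (hlam : IsLogBranch U lam) (hU : IsOpen U)
    (hU0 : ∀ a ∈ U, ∀ k, a k ≠ 0) {p : (Idx N → ℂ) × Vec} (hp : p.1 ∈ U) (ρ : Fin 5) :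
    AnalyticAt ℂ (fun q : (Idx N → ℂ) × Vec => autCoeff w lam q.1 ρ) p :=
  (analyticAt_const.mul ((hlam.analyticAt hU hU0 hp ρ).comp analyticAt_fst)).cexp'

theorem analyticAt_termFun (hlam : IsLogBranch U lam) (hU : IsOpen U)
    (hU0 : ∀ a ∈ U, ∀ k, a k ≠ 0) {p : (Idx N → ℂ) × Vec} (hp : p.1 ∈ U) (k : Idx N) :
    AnalyticAt ℂ (termFun w u lam k) p := by
  have h₁ : ∀ k, AnalyticAt ℂ (fun q : (Idx N → ℂ) × Vec => q.1 k) p := fun k =>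
    (analyticAt_coord k p.1).comp analyticAt_fst
  have h₂ : ∀ ρ, AnalyticAt ℂ (fun q : (Idx N → ℂ) × Vec => q.2 ρ) p := fun ρ =>
    (analyticAt_coord ρ p.2).comp analyticAt_snd
  refine (h₁ k).mul (Finset.analyticAt_fun_prod _ fun ρ _ => AnalyticAt.pow ?_ _)
  simp only [autom_apply]
  exact (analyticAt_autCoeff hlam hU hU0 hp ρ).mul (h₂ ρ)

theorem analyticAt_inverseDeriv (hlam : IsLogBranch U lam) (hU : IsOpen U)
    (hU0 : ∀ a ∈ U, ∀ k, a k ≠ 0) {p : (Idx N → ℂ) × Vec} (hp : p.1 ∈ U)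
    (hp0 : ∑ k, termFun w u lam k p ≠ 0) (n : Idx N → ℕ) :
    AnalyticAt ℂ (inverseDeriv w u lam n) p := by
  have h₁ : AnalyticAt ℂ (fun q : (Idx N → ℂ) × Vec => q.1 origin) p :=
    (analyticAt_coord _ p.1).comp analyticAt_fst
  have h₂ := fun k => analyticAt_termFun (w := w) (u := u) hlam hU hU0 hp k
  exact (((h₁.mul (Finset.analyticAt_fun_prod _ fun ρ _ =>
    analyticAt_autCoeff hlam hU hU0 hp ρ)).mul analyticAt_const).mul
    (Finset.analyticAt_fun_prod _ fun k _ => (h₂ k).pow _)).mul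
    (((Finset.analyticAt_fun_sum _ fun k _ => h₂ k).inv hp0).pow _)

/-- One more derivative of the inverse of a function linear in `a` raises the order of the pole by
one and brings down `-(|n| + 1)`. -/
theorem inverseDeriv_add_single (n : Idx N → ℕ) (k : Idx N) (p : (Idx N → ℂ) × Vec) :
    inverseDeriv w u lam (n + Pi.single k 1) p =
      -((∑ k, n k : ℕ) + 1) * termFun w u lam k p * (∑ k, termFun w u lam k p)⁻¹ *
        inverseDeriv w u lam n p := by
  have h₁ : ∑ j, (n + Pi.single k 1 : Idx N → ℕ) j = ∑ j, n j + 1 := by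
    simp [Finset.sum_add_distrib]
  have h₂ : ∏ j, termFun w u lam j p ^ (n + Pi.single k 1 : Idx N → ℕ) j =
      (∏ j, termFun w u lam j p ^ n j) * termFun w u lam k p := by
    simp only [Pi.add_apply, pow_add, Finset.prod_mul_distrib]
    congr 1
    rw [Finset.prod_eq_single k]
    · simp
    · intro j _ hj
      simp [hj]
    · simp
  rw [inverseDeriv, inverseDeriv, h₁, h₂, Nat.factorial_succ]
  push_cast
  ring

/-- The hypothesis on `μ` says that the pulled-back monomials all have the same logarithmic
derivative `μ` along the field. The numerator then contributes `|n| μ` and the denominator `-(|n| +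
1) μ`, leaving `-μ`; the variation of the `a_k` in the denominator gives the terms of order `|n| +
1`. -/
theorem fderiv_inverseDeriv (hlam : IsLogBranch U lam) (hU : IsOpen U)
    (hU0 : ∀ a ∈ U, ∀ k, a k ≠ 0) {p : (Idx N → ℂ) × Vec} (hp : p.1 ∈ U)
    (hp0 : ∑ k, termFun w u lam k p ≠ 0) (n : Idx N → ℕ) (s : Idx N → ℂ) (r : Fin 5 → ℂ) {μ : ℂ}
    (hμ : ∀ k, ∑ ρ, (expo w u k ρ : ℂ) *
      ((w ρ : ℂ) / (deg w : ℂ) * (s origin - s (vertex ρ)) + r ρ) = μ) :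
    fderiv ℂ (inverseDeriv w u lam n) p (scaling s r p) =
      (s origin + ∑ ρ, (w ρ : ℂ) / (deg w : ℂ) * (s origin - s (vertex ρ)) +
        ∑ k, n k * s k - μ) * inverseDeriv w u lam n p +
      ∑ k, s k * inverseDeriv w u lam (n + Pi.single k 1) p := by
  set q : ℂ → (Idx N → ℂ) × Vec := fun t => p + t • scaling s r p with hq
  have hq0 : q 0 = p := by simp [hq]
  have hq1 : ∀ t, (q t).1 = p.1 + t • (s * p.1) := fun t => by simp [hq, scaling_apply]
  have hline : HasDerivAt q (scaling s r p) 0 := hasDerivAt_line _ _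
  have ha : ∀ k, HasLogDerivAt (fun t => (q t).1 k) (s k) := by
    intro k
    have := hasDerivAt_pi.1 (hasDerivAt_line p.1 (s * p.1)) k
    simp only [HasLogDerivAt, hq1, hq0]
    exact this
  have hz : ∀ ρ, HasLogDerivAt (fun t => (q t).2 ρ) (r ρ) := by
    intro ρ
    have := hasDerivAt_pi.1 (hasDerivAt_line p.2 (diagField r p.2)) ρ
    have h2 : ∀ t, (q t).2 = p.2 + t • diagField r p.2 := fun t => by simp [hq, scaling_apply]
    simp only [HasLogDerivAt, h2, hq0]
    simpa [diagField] using this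
  have hc : ∀ ρ, HasLogDerivAt (fun t => autCoeff w lam (q t).1 ρ)
      ((w ρ : ℂ) / (deg w : ℂ) * (s origin - s (vertex ρ))) := by
    intro ρ
    refine HasLogDerivAt.exp ?_
    simp only [hq1]
    exact (hlam.hasDerivAt_line hU hU0 hp s ρ).const_mul _
  have hterm : ∀ k, HasLogDerivAt (fun t => termFun w u lam k (q t)) (s k + μ) := by
    intro k
    rw [← hμ k]
    refine (ha k).mul (HasLogDerivAt.prod _ fun ρ _ => HasLogDerivAt.pow ?_ _)
    simp only [autom_apply]
    exact (hc ρ).mul (hz ρ)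
  have hsum : HasDerivAt (fun t => ∑ k, termFun w u lam k (q t))
      (∑ k, (s k + μ) * termFun w u lam k p) 0 := by
    have := HasDerivAt.fun_sum (u := Finset.univ) (x := (0 : ℂ))
      fun k _ => (hterm k : HasDerivAt _ _ _)
    simpa only [hq0] using this
  have hinv : HasLogDerivAt (fun t => (∑ k, termFun w u lam k (q t))⁻¹)
      (-(∑ k, termFun w u lam k p)⁻¹ * ∑ k, (s k + μ) * termFun w u lam k p) := by
    have := hsum.fun_inv (by rwa [hq0])
    unfold HasLogDerivAt
    convert! this using 1
    simp only [hq0]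
    field_simp
  have hall : HasLogDerivAt (fun t => inverseDeriv w u lam n (q t)) _ :=
    ((((ha origin).mul (HasLogDerivAt.prod _ fun ρ _ => hc ρ)).mul
      (HasLogDerivAt.const _)).mul (HasLogDerivAt.prod _ fun k _ => (hterm k).pow (n k))).mul
      (hinv.pow _)
  have hdiff : HasFDerivAt (inverseDeriv w u lam n)
      (fderiv ℂ (inverseDeriv w u lam n) p) (q 0) := by
    rw [hq0]
    exact (analyticAt_inverseDeriv hlam hU hU0 hp hp0 n).differentiableAt.hasFDerivAt
  rw [(hdiff.comp_hasDerivAt 0 hline).unique hall]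
  have h₁ : ∑ k, s k * inverseDeriv w u lam (n + Pi.single k 1) p =
      -((∑ k, n k : ℕ) + 1) * (∑ k, termFun w u lam k p)⁻¹ *
        (∑ k, s k * termFun w u lam k p) * inverseDeriv w u lam n p := by
    rw [Finset.mul_sum, Finset.sum_mul]
    exact Finset.sum_congr rfl fun k _ => by rw [inverseDeriv_add_single]; ring
  have h₂ : ∑ k, (s k + μ) * termFun w u lam k p =
      ∑ k, s k * termFun w u lam k p + μ * ∑ k, termFun w u lam k p := by
    simp only [add_mul, Finset.sum_add_distrib, Finset.mul_sum]
  have h₃ : ∑ k, (n k : ℂ) * (s k + μ) = ∑ k, (n k : ℂ) * s k + (∑ k, n k : ℕ) * μ := by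
    push_cast
    simp only [mul_add, Finset.sum_add_distrib, Finset.sum_mul]
  have h₄ : (fun t => inverseDeriv w u lam n (q t)) 0 = inverseDeriv w u lam n p := by
    simp only [hq0]
  rw [h₄, h₁, h₂, h₃, Nat.cast_add, Nat.cast_one]
  -- The `μ`-part of the derivative of the denominator carries `P⁻¹ * P`, where `P` is the
  -- pulled-back polynomial; this cancels it.
  linear_combination (-((∑ k, n k : ℕ) + 1) * μ * inverseDeriv w u lam n p) *
    inv_mul_cancel₀ hp0

end Derivatives

/-! ### The regular set and quasi-homogeneity -/

section Geometry

variable {w : Fin 5 → ℕ} {N : ℕ} {u : Fin N → Fin 4 → ℤ} {lam : Fin 5 → (Idx N → ℂ) → ℂ}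
  {U : Set (Idx N → ℂ)}

theorem mem_regularSet_iff (hlast : w (Fin.last 4) = 1) (hfermat : ∀ ρ, w ρ ∣ deg w)
    (hu : IsEnumeration w u) {p : (Idx N → ℂ) × Vec} :
    p ∈ regularSet w u U lam ↔ p.1 ∈ U ∧ ∑ k, termFun w u lam k p ≠ 0 := by
  rw [← cyPoly_autom hlast hfermat hu]
  rfl

theorem isOpen_regularSet (hlast : w (Fin.last 4) = 1) (hfermat : ∀ ρ, w ρ ∣ deg w)
    (hu : IsEnumeration w u) (hlam : IsLogBranch U lam) (hU : IsOpen U)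
    (hU0 : ∀ a ∈ U, ∀ k, a k ≠ 0) : IsOpen (regularSet w u U lam) := by
  refine isOpen_iff_mem_nhds.2 fun p hp => ?_
  rw [mem_regularSet_iff hlast hfermat hu] at hp
  have hcont : ContinuousAt (fun q => ∑ k, termFun w u lam k q) p :=
    (Finset.analyticAt_fun_sum _ fun k _ =>
      analyticAt_termFun hlam hU hU0 hp.1 k).continuousAt
  filter_upwards [continuousAt_fst.eventually (hU.mem_nhds hp.1), hcont.eventually_ne hp.2]
    with q hq₁ hq₂
  exact (mem_regularSet_iff hlast hfermat hu).2 ⟨hq₁, hq₂⟩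

/-- The exponents of a monomial of degree `d`, weighted by `w_ρ / d`, add up to `1`. -/
theorem sum_expo_mul_weight_div_deg (hpos : ∀ ρ, 0 < w ρ) (hlast : w (Fin.last 4) = 1)
    (hfermat : ∀ ρ, w ρ ∣ deg w) (hu : IsEnumeration w u) (k : Idx N) :
    ∑ ρ, (expo w u k ρ : ℂ) * ((w ρ : ℂ) / (deg w : ℂ)) = 1 := by
  have hd : (deg w : ℂ) ≠ 0 := by
    have : 0 < deg w := Finset.sum_pos (fun ρ _ => hpos ρ) Finset.univ_nonempty
    exact_mod_cast this.ne'
  have h := sum_mul_pairing_ray hfermat (point w u k)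
  simp only [← coe_expo hlast hfermat hu] at h
  have h' : ∑ ρ, (w ρ : ℂ) * (expo w u k ρ : ℂ) = deg w := by exact_mod_cast h
  have h₂ : ∑ ρ, (expo w u k ρ : ℂ) * ((w ρ : ℂ) / (deg w : ℂ)) =
      (∑ ρ, (w ρ : ℂ) * (expo w u k ρ : ℂ)) / deg w := by
    rw [Finset.sum_div]
    exact Finset.sum_congr rfl fun ρ _ => by ring
  rw [h₂, h', div_self hd]

theorem sum_coordCoeff (hpos : ∀ ρ, 0 < w ρ) : ∑ ρ, (w ρ : ℂ) / (deg w : ℂ) = 1 := by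
  have hd : (deg w : ℂ) ≠ 0 := by
    have : 0 < deg w := Finset.sum_pos (fun ρ _ => hpos ρ) Finset.univ_nonempty
    exact_mod_cast this.ne'
  rw [← Finset.sum_div, div_eq_one_iff_eq hd]
  simp [deg]

end Geometry

/-! ### The shifted factors as first-order operators -/

section Action

variable {w : Fin 5 → ℕ} {N : ℕ} {u : Fin N → Fin 4 → ℤ} {lam : Fin 5 → (Idx N → ℂ) → ℂ}
  {U : Set (Idx N → ℂ)} {S : Opens ((Idx N → ℂ) × Vec)}

/-- The coefficients of the vector field added to `a_k ∂/∂a_k` in `lieFactor`. -/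
def shift (w : Fin 5 → ℕ) {N : ℕ} : Idx N → Fin 5 → ℂ
  | some (Sum.inl i) => coordCoeff w i
  | _ => 0

theorem fderiv_scaling_add (g : AnalyticFun S) (p : (Idx N → ℂ) × Vec) (s : Idx N → ℂ)
    (c : Fin 5 → ℂ) : fderiv ℂ g p (scaling s c p) =
      fderiv ℂ g p (scaling s 0 p) + fderiv ℂ g p (scaling 0 c p) := by
  rw [← map_add]
  congr 1
  simp only [scaling_apply]
  ext <;> simp [diagField]

theorem lieFactorOp_apply (f : Idx N × ℕ) (g : AnalyticFun S) {p : (Idx N → ℂ) × Vec}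
    (hp : p ∈ S) : (lieFactorOp w S f g) p =
      fderiv ℂ g p (scaling (Pi.single f.1 1) (shift w f.1) p) +
        (∑ ρ, shift w f.1 ρ - f.2) * g p := by
  have h₁ : (factorOp S f g) p =
      fderiv ℂ g p (scaling (Pi.single f.1 1) 0 p) - f.2 * g p := by
    rw [← lieOp_apply _ _ hp]
    rfl
  have h₂ : ∀ c, (lieDerivOp S c g) p =
      fderiv ℂ g p (scaling 0 c p) + (∑ ρ, c ρ) * g p := by
    intro c
    rw [← lieOp_apply _ _ hp]
    rfl
  have h₃ : (∑ i, if f.1 = vertex i then lieDerivOp S (coordCoeff w i) else 0) =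
      if f.1 ∈ Set.range (vertex (N := N)) then lieDerivOp S (shift w f.1) else 0 := by
    match f.1 with
    | none => simp
    | some (Sum.inl i) => simp [shift]
    | some (Sum.inr k) => simp
  have h₄ : f.1 ∉ Set.range (vertex (N := N)) → shift w f.1 = 0 := by
    match f.1 with
    | none => simp [shift]
    | some (Sum.inl i) => simp
    | some (Sum.inr k) => simp [shift]
  rw [lieFactorOp, LinearMap.add_apply, AnalyticFun.add_apply, h₁, h₃,
    fderiv_scaling_add g p _ (shift w f.1)]
  split_ifs with h
  · rw [h₂]
    ring
  · rw [h₄ h]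
    have : scaling (0 : Idx N → ℂ) 0 p = 0 := by
      rw [scaling_apply]
      ext <;> simp [diagField]
    rw [LinearMap.zero_apply, AnalyticFun.zero_apply, this, map_zero]
    simp
    ring

end Action

/-! ### The operators on the coefficient functions -/

/-- The standing assumptions on the weights, the points, and the branches. -/
structure IsToricData (w : Fin 5 → ℕ) {N : ℕ} (u : Fin N → Fin 4 → ℤ) (U : Set (Idx N → ℂ))
    (lam : Fin 5 → (Idx N → ℂ) → ℂ) : Prop where
  pos : ∀ ρ, 0 < w ρ
  last : w (Fin.last 4) = 1
  fermat : ∀ ρ, w ρ ∣ deg w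
  enum : IsEnumeration w u
  isOpen : IsOpen U
  ne_zero : ∀ a ∈ U, ∀ k, a k ≠ 0
  branch : IsLogBranch U lam

namespace IsToricData

variable {w : Fin 5 → ℕ} {N : ℕ} {u : Fin N → Fin 4 → ℤ} {lam : Fin 5 → (Idx N → ℂ) → ℂ}
  {U : Set (Idx N → ℂ)} (h : IsToricData w u U lam)

/-- The regular set as an open set. -/
def regularOpens : Opens ((Idx N → ℂ) × Vec) :=
  ⟨regularSet w u U lam,
    isOpen_regularSet h.last h.fermat h.enum h.branch h.isOpen h.ne_zero⟩

theorem mem_regularOpens {p : (Idx N → ℂ) × Vec} :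
    p ∈ h.regularOpens ↔ p.1 ∈ U ∧ ∑ k, termFun w u lam k p ≠ 0 :=
  mem_regularSet_iff h.last h.fermat h.enum

theorem analyticOnNhd_inverseDeriv (n : Idx N → ℕ) :
    AnalyticOnNhd ℂ (inverseDeriv w u lam n) (h.regularOpens : Set ((Idx N → ℂ) × Vec)) :=
  fun _ hp => analyticAt_inverseDeriv h.branch h.isOpen h.ne_zero (h.mem_regularOpens.1 hp).1
    (h.mem_regularOpens.1 hp).2 n

/-- The function `inverseDeriv` on the regular set. -/
def coeff (n : Idx N → ℕ) : AnalyticFun h.regularOpens :=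
  restrictAnalytic h.regularOpens (inverseDeriv w u lam n) (h.analyticOnNhd_inverseDeriv n)

theorem coeff_apply (n : Idx N → ℕ) {p : (Idx N → ℂ) × Vec} (hp : p ∈ h.regularOpens) :
    h.coeff n p = inverseDeriv w u lam n p :=
  restrictAnalytic_apply (h.analyticOnNhd_inverseDeriv n) hp

theorem fderiv_coeff (n : Idx N → ℕ) {p : (Idx N → ℂ) × Vec} (hp : p ∈ h.regularOpens)
    (s : Idx N → ℂ) (r : Fin 5 → ℂ) {μ : ℂ}
    (hμ : ∀ k, ∑ ρ, (expo w u k ρ : ℂ) *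
      ((w ρ : ℂ) / (deg w : ℂ) * (s origin - s (vertex ρ)) + r ρ) = μ) :
    fderiv ℂ (h.coeff n) p (scaling s r p) =
      (s origin + ∑ ρ, (w ρ : ℂ) / (deg w : ℂ) * (s origin - s (vertex ρ)) +
        ∑ k, n k * s k - μ) * h.coeff n p +
      ∑ k, s k * h.coeff (n + Pi.single k 1) p := by
  have he : ⇑(h.coeff n) =ᶠ[𝓝 p] inverseDeriv w u lam n := by
    filter_upwards [h.regularOpens.isOpen.mem_nhds hp] with q hq using h.coeff_apply n hq
  rw [he.fderiv_eq, fderiv_inverseDeriv h.branch h.isOpen h.ne_zero (h.mem_regularOpens.1 hp).1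
    (h.mem_regularOpens.1 hp).2 n s r hμ, h.coeff_apply n hp]
  congr 1
  exact Finset.sum_congr rfl fun k _ => by rw [h.coeff_apply _ hp]

/-- Each shifted factor performs one more differentiation in `a_k` before the pullback, since
`a_k^{n+1} ∂_k^{n+1} = (a_k ∂_k - n) a_k^n ∂_k^n`. The prefactor `a_0` raises the constant by one at
the origin. -/
theorem lieFactorOp_coeff (k : Idx N) (n : Idx N → ℕ) :
    lieFactorOp w h.regularOpens (k, n k + if k = origin then 1 else 0) (h.coeff n) =
      h.coeff (n + Pi.single k 1) := by
  refine AnalyticFun.ext_of_mem fun p hp => ?_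
  have hsum : ∀ m : Idx N → ℂ, ∑ j, m j * (Pi.single k 1 : Idx N → ℂ) j = m k := by
    intro m
    simp [Pi.single_apply]
  have hsum' : ∑ j, (Pi.single k 1 : Idx N → ℂ) j * h.coeff (n + Pi.single j 1) p =
      h.coeff (n + Pi.single k 1) p := by
    simp [Pi.single_apply]
  rw [lieFactorOp_apply _ _ hp]
  match k with
  | none =>
    -- Here `μ = 1` by quasi-homogeneity. It cancels the logarithmic derivative `∑ w_ρ / d = 1` of
    -- the Jacobian, and the prefactor `a_0` leaves `n_0 + 1`.
    rw [h.fderiv_coeff n hp _ _ (μ := 1), hsum, hsum']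
    · simp [shift, sum_coordCoeff h.pos]
      ring
    · intro k
      simpa [shift] using sum_expo_mul_weight_div_deg h.pos h.last h.fermat h.enum k
  | some (Sum.inl i) =>
    have hc : ∀ ρ, (w ρ : ℂ) / (deg w : ℂ) * ((Pi.single (vertex i) 1 : Idx N → ℂ) origin -
        (Pi.single (vertex i) 1 : Idx N → ℂ) (vertex ρ)) = -shift w (vertex (N := N) i) ρ := by
      intro ρ
      by_cases hρ : ρ = i
      · subst hρ
        simp [shift, coordCoeff]
      · simp [shift, coordCoeff, hρ]
    -- The field `X_i` undoes the motion of the automorphism, so `μ = 0`; its divergence `w_i / d`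
    -- cancels the derivative of the Jacobian.
    rw [h.fderiv_coeff n hp _ _ (μ := 0), hsum, hsum']
    · simp only [hc]
      simp
      ring
    · intro k
      simp only [hc]
      simp
  | some (Sum.inr i) =>
    rw [h.fderiv_coeff n hp _ _ (μ := 0), hsum, hsum']
    · simp [shift]
    · intro k
      simp [shift]

/-- The labels of the factors of the point `k`. -/
def block (k : Idx N) (m : ℕ) : List (Idx N × ℕ) :=
  (List.range m).map fun j => (k, j + if k = origin then 1 else 0)

theorem prod_block_coeff (k : Idx N) (m : ℕ) (n : Idx N → ℕ) (hn : n k = 0) :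
    ((block k m).map (lieFactorOp w h.regularOpens)).prod (h.coeff n) =
      h.coeff (n + Pi.single k m) := by
  induction m with
  | zero => simp [block]
  | succ m ih =>
    -- The last factor of the list acts first, whereas the induction needs the one with the largest
    -- constant to act last; commutativity exchanges them.
    have hc := commute_prod_lieFactorOp w (fun s c => lieOp_commute_lieFactorOp
      (S := h.regularOpens) w s c (k, m + if k = origin then 1 else 0)) (block k m)
    have hb : block k (m + 1) = block k m ++ [(k, m + if k = origin then 1 else 0)] := by
      simp [block, List.range_succ]
    have hs := h.lieFactorOp_coeff k (n + Pi.single k m)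
    rw [Pi.add_apply, hn, Pi.single_eq_same, zero_add] at hs
    rw [hb, List.map_append, List.prod_append, List.map_singleton, List.prod_singleton, hc.eq,
      Module.End.mul_apply, ih, hs, add_assoc, ← Pi.single_add]

theorem prod_flatMap_block_coeff (m : Idx N → ℕ) (ks : List (Idx N)) (hks : ks.Nodup) :
    ((ks.flatMap fun k => block k (m k)).map (lieFactorOp w h.regularOpens)).prod (h.coeff 0) =
      h.coeff (ks.map fun k => Pi.single k (m k)).sum := by
  induction ks with
  | nil => simp
  | cons k ks ih =>
    rw [List.nodup_cons] at hks
    have hk : (ks.map fun k => (Pi.single k (m k) : Idx N → ℕ)).sum k = 0 := by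
      rw [← List.sum_toFinset _ hks.2, Finset.sum_apply]
      refine Finset.sum_eq_zero fun j hj => Pi.single_eq_of_ne ?_ _
      rintro rfl
      exact hks.1 (List.mem_toFinset.1 hj)
    rw [List.flatMap_cons, List.map_append, List.prod_append, Module.End.mul_apply, ih hks.2,
      h.prod_block_coeff _ _ _ hk, List.map_cons, List.sum_cons, add_comm]

theorem factors_eq (l : Idx N → ℤ) :
    factors l = (origin :: ((List.finRange 5).map vertex ++ (List.finRange N).map other)).flatMap
      fun k => block k (l k).toNat := by
  simp [factors, block, List.flatMap_append, List.flatMap_map]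

theorem nodup_labels :
    (origin :: ((List.finRange 5).map vertex ++ (List.finRange N).map other) :
      List (Idx N)).Nodup := by
  rw [List.nodup_cons, List.nodup_append]
  refine ⟨by simp, (List.nodup_finRange 5).map fun i j hij => by simpa using hij,
    (List.nodup_finRange N).map fun i j hij => by simpa using hij, ?_⟩
  simp

theorem prod_factors_coeff (l : Idx N → ℤ) :
    ((factors l).map (lieFactorOp w h.regularOpens)).prod (h.coeff 0) =
      h.coeff fun k => (l k).toNat := by
  rw [factors_eq, h.prod_flatMap_block_coeff (fun k => (l k).toNat) _ nodup_labels,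
    ← List.sum_toFinset _ nodup_labels]
  congr 1
  have : (origin :: ((List.finRange 5).map vertex ++ (List.finRange N).map other) :
      List (Idx N)).toFinset = Finset.univ := by
    ext k
    match k with
    | none => simp
    | some (Sum.inl i) => simp
    | some (Sum.inr i) => simp
  rw [this]
  exact Finset.univ_sum_single fun k => (l k).toNat

/-- `∑ l_k = 0` equates the total orders of the two parts of `l`, hence sign, factorial and pole
order; together with `∑ l_k v*_k = 0` it equates the exponents of each coordinate. Only the powers
of the `a_k` differ. -/
theorem inverseDeriv_toNat (h : IsToricData w u U lam)
    {l : Idx N → ℤ} (hl : l ∈ relationLattice w u)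
    {p : (Idx N → ℂ) × Vec} (hp : p.1 ∈ U) :
    inverseDeriv w u lam (fun k => (l k).toNat) p =
      monomial l p.1 * inverseDeriv w u lam (fun k => ((-l) k).toNat) p := by
  have hsub : ∀ k, ((l k).toNat : ℤ) - (((-l) k).toNat : ℤ) = l k := fun k =>
    Int.toNat_sub_toNat_neg (l k)
  have hcard : ∑ k, (l k).toNat = ∑ k, ((-l) k).toNat := by
    have : ∑ k, (((l k).toNat : ℤ) - (((-l) k).toNat : ℤ)) = 0 := by
      simp only [hsub, hl.1]
    rw [Finset.sum_sub_distrib, sub_eq_zero] at this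
    exact_mod_cast this
  have hexp : ∀ ρ, ∑ k, expo w u k ρ * (l k).toNat = ∑ k, expo w u k ρ * ((-l) k).toNat := by
    intro ρ
    have h₀ : ∑ k, l k * pairing (point w u k) (ray w ρ) = 0 := by
      have h₁ : ∀ j, ∑ k, l k * point w u k j = 0 := fun j => by
        simpa using congrFun hl.2 j
      simp only [pairing, Finset.mul_sum]
      rw [Finset.sum_comm]
      refine Finset.sum_eq_zero fun j _ => ?_
      simp only [← mul_assoc]
      rw [← Finset.sum_mul, h₁, zero_mul]
    have : ∑ k, (expo w u k ρ : ℤ) * (((l k).toNat : ℤ) - (((-l) k).toNat : ℤ)) = 0 := by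
      simp only [hsub, coe_expo h.last h.fermat h.enum]
      have h₂ : ∀ k, (pairing (point w u k) (ray w ρ) + 1) * l k =
          l k * pairing (point w u k) (ray w ρ) + l k := fun k => by ring
      rw [Finset.sum_congr rfl fun k _ => h₂ k, Finset.sum_add_distrib, h₀, hl.1, add_zero]
    simp only [mul_sub, Finset.sum_sub_distrib, sub_eq_zero] at this
    exact_mod_cast this
  have hprod : ∀ n : Idx N → ℕ, ∏ k, termFun w u lam k p ^ n k =
      (∏ k, p.1 k ^ n k) * ∏ ρ, autom w lam p.1 p.2 ρ ^ ∑ k, expo w u k ρ * n k := by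
    intro n
    simp only [termFun, mul_pow, Finset.prod_mul_distrib, ← Finset.prod_pow, ← pow_mul]
    rw [Finset.prod_comm]
    simp only [Finset.prod_pow_eq_pow_sum]
  have hmon : ∏ k, p.1 k ^ (l k).toNat = monomial l p.1 * ∏ k, p.1 k ^ ((-l) k).toNat := by
    rw [monomial, ← Finset.prod_mul_distrib]
    refine Finset.prod_congr rfl fun k _ => ?_
    rw [← zpow_natCast, ← zpow_natCast, ← zpow_add₀ (h.ne_zero p.1 hp k)]
    congr 1
    linarith [hsub k]
  simp only [inverseDeriv, hprod, hcard, hexp, hmon]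
  ring

end IsToricData

/-! ### Contractions -/

theorem differentiableWithinAt_curryLeft_apply {E : Type*} [NormedAddCommGroup E]
    [NormedSpace ℂ E] {k : ℕ} {ω : E → Vec [⋀^Fin (k + 1)]→L[ℂ] ℂ} {v : E → Vec} {s : Set E}
    {x : E} (hω : DifferentiableWithinAt ℂ ω s x) (hv : DifferentiableWithinAt ℂ v s x) :
    DifferentiableWithinAt ℂ (fun y => (ω y).curryLeft (v y)) s x :=
  (DifferentiableAt.comp_differentiableWithinAt
    (g := fun η : Vec [⋀^Fin (k + 1)]→L[ℂ] ℂ => η.curryLeft) x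
    (ContinuousAlternatingMap.curryLeftLI (𝕜 := ℂ) (E := Vec)
      (F := ℂ)).toContinuousLinearMap.differentiableAt hω).clm_apply hv

/-- Evaluates the sum pointwise, for the differentiability of `β_l` jointly in `(a, z)`. -/
theorem contractSum_apply (w : Fin 5 → ℕ) (α : Fin 5 → Form 4) (z : Vec) :
    contractSum w α z = ∑ i, interior (diagField (coordCoeff w i)) (α i) z := by
  rw [contractSum, Finset.sum_apply]

theorem extDeriv_contractSum (w : Fin 5 → ℕ) {α : Fin 5 → Form 4} {z : Vec}
    (hα : ∀ i, DifferentiableAt ℂ (α i) z) (hd : ∀ i, extDeriv (α i) z = 0) :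
    extDeriv (contractSum w α) z = ∑ i, lieDeriv (coordCoeff w i) (α i) z := by
  have h₁ : extDeriv (contractSum w α) z =
      ∑ i, extDeriv (interior (diagField (coordCoeff w i)) (α i)) z := by
    simp only [extDeriv, contractSum]
    rw [fderiv_sum fun i _ => (hasFDerivAt_interior _ (hα i)).differentiableAt]
    exact map_sum (ContinuousAlternatingMap.alternatizeUncurryFinCLM ℂ Vec ℂ) _ _
  rw [h₁]
  refine Finset.sum_congr rfl fun i _ => ?_
  rw [lieDeriv_eq_extDeriv_interior _ (hα i), interior, hd i,
    ContinuousAlternatingMap.curryLeft_zero]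
  exact (zero_add _).symm

theorem interior_sum {k : ℕ} {ι : Type*} (s : Finset ι) (X : Vec → Vec) (ω : ι → Form (k + 1))
    (z : Vec) : interior X (∑ i ∈ s, ω i) z = ∑ i ∈ s, interior X (ω i) z := by
  ext v
  simp [interior, ContinuousAlternatingMap.sum_apply]

theorem interior_comm {k : ℕ} (X Y : Vec → Vec) (ω : Form (k + 2)) (z : Vec) :
    interior X (interior Y ω) z = -interior Y (interior X ω) z := by
  -- Polarization of the vanishing of the double contraction with `x + y`.
  have h : ∀ x y : Vec, ((ω z).curryLeft x).curryLeft y = -((ω z).curryLeft y).curryLeft x := by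
    intro x y
    have h₁ := ContinuousAlternatingMap.curryLeft_same (ω z) (x + y)
    have h₂ := ContinuousAlternatingMap.curryLeft_same (ω z) x
    have h₃ := ContinuousAlternatingMap.curryLeft_same (ω z) y
    simp only [map_add, ContinuousAlternatingMap.curryLeft_add, add_apply,
      h₂, h₃, zero_add, add_zero] at h₁
    exact eq_neg_of_add_eq_zero_right h₁
  exact h (Y z) (X z)

theorem interior_euler_of_eq_smul (w : Fin 5 → ℕ) {ω : Form 4} {z : Vec} {c : ℂ}
    (h : ω z = c • omegaZero w z) : interior (diagField (eulerCoeff w)) ω z = 0 := by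
  have h₀ := interior_euler_omegaZero w z
  rw [interior] at h₀
  rw [interior, h, ContinuousAlternatingMap.curryLeft_smul, _root_.smul_apply, h₀, smul_zero]

theorem interior_euler_contractSum (w : Fin 5 → ℕ) {α : Fin 5 → Form 4} {z : Vec} (g : Fin 5 → ℂ)
    (hα : ∀ i, α i z = g i • omegaZero w z) :
    interior (diagField (eulerCoeff w)) (contractSum w α) z = 0 := by
  rw [contractSum, interior_sum]
  refine Finset.sum_eq_zero fun i _ => ?_
  have h₂ : interior (diagField (eulerCoeff w)) (α i) z = 0 :=
    interior_euler_of_eq_smul w (hα i)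
  rw [interior_comm (k := 2), interior, h₂, ContinuousAlternatingMap.curryLeft_zero]
  simp

/-- Cartan's formula: `d ι_E ω` vanishes because `ι_E ω` is zero near `z`, and `ι_E dω` because `ι_E
Ω_0 = 0`. -/
theorem lieDeriv_euler_eq_zero (w : Fin 5 → ℕ) {ω : Form 3} {z : Vec} {c : ℂ}
    (hω : DifferentiableAt ℂ ω z)
    (h₁ : interior (diagField (eulerCoeff w)) (k := 2) ω =ᶠ[𝓝 z] 0)
    (h₂ : extDeriv ω z = c • omegaZero w z) : lieDeriv (eulerCoeff w) ω z = 0 := by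
  have h₃ : extDeriv (0 : Form 2) z = 0 := by
    rw [extDeriv, fderiv_zero]
    exact map_zero (ContinuousAlternatingMap.alternatizeUncurryFinCLM ℂ Vec ℂ (n := 2))
  rw [lieDeriv_eq_extDeriv_interior (k := 2) _ hω, h₁.extDeriv_eq, h₃, add_zero]
  exact interior_euler_of_eq_smul w (ω := extDeriv ω) h₂

/-! ### The coefficients of the forms -/

namespace IsToricData

variable {w : Fin 5 → ℕ} {N : ℕ} {u : Fin N → Fin 4 → ℤ} {lam : Fin 5 → (Idx N → ℂ) → ℂ}
  {U : Set (Idx N → ℂ)} (h : IsToricData w u U lam)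

theorem isCoeff_piTilde : IsCoeff w (piTilde w u lam) (h.coeff 0) := by
  intro p hp
  have h₁ : pullback (autom w lam p.1) (piForm w u p.1) p.2 =
      (cyPoly w u p.1 (autom w lam p.1 p.2))⁻¹ •
        pullback (autom w lam p.1) (omegaZero w) p.2 := rfl
  have h₂ : pullback (autom w lam p.1) (omegaZero w) p.2 =
      (∏ ρ, autCoeff w lam p.1 ρ) • omegaZero w p.2 := pullback_omegaZero w _ _
  change p.1 origin • pullback (autom w lam p.1) (piForm w u p.1) p.2 = _
  rw [h₁, h₂, h.coeff_apply _ hp, cyPoly_autom h.last h.fermat h.enum, smul_smul, smul_smul]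
  congr 1
  simp [inverseDeriv]
  ring

theorem analyticOnNhd_monomial (l : Idx N → ℤ) :
    AnalyticOnNhd ℂ (fun p : (Idx N → ℂ) × Vec => monomial l p.1)
      (h.regularOpens : Set ((Idx N → ℂ) × Vec)) := fun p hp =>
  Finset.analyticAt_fun_prod _ fun k _ => AnalyticAt.zpow
    ((analyticAt_coord k p.1).comp analyticAt_fst)
    (h.ne_zero p.1 (h.mem_regularOpens.1 hp).1 k)

/-- Multiplication by the monomial `a^l`. -/
def monomialOp (l : Idx N → ℤ) : Module.End ℂ (AnalyticFun h.regularOpens) :=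
  mulOp h.regularOpens (fun p => monomial l p.1) (h.analyticOnNhd_monomial l)

theorem isCoeff_monomial_smul (l : Idx N → ℤ) {F : Family N 4} {g : AnalyticFun h.regularOpens}
    (hF : IsCoeff w F g) :
    IsCoeff w (fun a => monomial l a • F a) (h.monomialOp l g) := fun p hp =>
  (congrArg (monomial l p.1 • ·) (hF p hp)).trans (mul_smul (monomial l p.1) (g p) _).symm

/-- `a^l` is constant along `z`. The vanishing parameter component of `scaling 0 c` is essential
here. -/
theorem commute_lieOp_monomialOp (l : Idx N → ℤ) (c : Fin 5 → ℂ) :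
    Commute (lieOp h.regularOpens (scaling 0 c)) (h.monomialOp l) := by
  refine lieOp_mulOp_commute _ fun p hp => ?_
  have hd := (h.analyticOnNhd_monomial l p hp).differentiableAt.hasFDerivAt
  have hline : HasDerivAt (fun t : ℂ => p + t • scaling 0 c p) (scaling 0 c p) 0 :=
    hasDerivAt_line _ _
  have h₀ : p + (0 : ℂ) • scaling 0 c p = p := by simp
  have h₁ := HasFDerivAt.comp_hasDerivAt (x := (0 : ℂ)) (f := fun t : ℂ => p + t • scaling 0 c p)
    (l := fun p : (Idx N → ℂ) × Vec => monomial l p.1) (by simpa only [h₀] using hd) hline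
  refine h₁.unique ?_
  have h₂ : (fun p : (Idx N → ℂ) × Vec => monomial l p.1) ∘ (fun t : ℂ => p + t • scaling 0 c p) =
      fun _ => monomial l p.1 := by
    funext t
    simp [scaling_apply]
  rw [h₂]
  exact hasDerivAt_const _ _

theorem commute_lieDerivOp_monomialOp (l : Idx N → ℤ) (c : Fin 5 → ℂ) :
    Commute (lieDerivOp h.regularOpens c) (h.monomialOp l) :=
  (h.commute_lieOp_monomialOp l c).add_left ((Commute.one_left _).smul_left _)

/-- The coefficient of `alpha`. -/
def alphaCoeff (l : Idx N → ℤ) (i : Fin 5) : AnalyticFun h.regularOpens :=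
  lieCofactorOp w h.regularOpens i (factors l) (h.coeff 0) -
    h.monomialOp l (lieCofactorOp w h.regularOpens i (factors (-l)) (h.coeff 0))

theorem isCoeff_alpha (l : Idx N → ℤ) (i : Fin 5) :
    IsCoeff w (alpha w u lam l i) (h.alphaCoeff l i) :=
  (h.isCoeff_piTilde.lieCofactor i _).sub
    (h.isCoeff_monomial_smul l (h.isCoeff_piTilde.lieCofactor i _))

theorem isCoeff_gkz {l : Idx N → ℤ} (hl : l ∈ relationLattice w u) :
    IsCoeff w (gkz l (piTilde w u lam))
      (-∑ i, lieDerivOp h.regularOpens (coordCoeff w i) (h.alphaCoeff l i)) := by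
  have hsum : ∀ l' : Idx N → ℤ, ∑ i, lieDerivOp h.regularOpens (coordCoeff w i)
      (lieCofactorOp w h.regularOpens i (factors l') (h.coeff 0)) =
      h.coeff (fun k => (l' k).toNat) -
        ((factors l').map (factorOp h.regularOpens)).prod (h.coeff 0) := by
    intro l'
    have := congrArg (fun T : Module.End ℂ (AnalyticFun h.regularOpens) => T (h.coeff 0))
      (sum_lieDerivOp_mul_lieCofactorOp (S := h.regularOpens) w (factors l'))
    simp only [LinearMap.sum_apply, Module.End.mul_apply, LinearMap.sub_apply,
      h.prod_factors_coeff] at this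
    exact this
  have hrel : h.coeff (fun k => (l k).toNat) =
      h.monomialOp l (h.coeff fun k => ((-l) k).toNat) := by
    refine AnalyticFun.ext_of_mem fun p hp => ?_
    rw [monomialOp, mulOp_apply, h.coeff_apply _ hp, h.coeff_apply _ hp,
      h.inverseDeriv_toNat hl (h.mem_regularOpens.1 hp).1]
  have hcomm : ∀ i g, lieDerivOp h.regularOpens (coordCoeff w i) (h.monomialOp l g) =
      h.monomialOp l (lieDerivOp h.regularOpens (coordCoeff w i) g) := fun i g =>
    congrArg (fun T : Module.End ℂ (AnalyticFun h.regularOpens) => T g)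
      (h.commute_lieDerivOp_monomialOp l (coordCoeff w i)).eq
  have heq : -∑ i, lieDerivOp h.regularOpens (coordCoeff w i) (h.alphaCoeff l i) =
      ((factors l).map (factorOp h.regularOpens)).prod (h.coeff 0) - h.monomialOp l
        (((factors (-l)).map (factorOp h.regularOpens)).prod (h.coeff 0)) := by
    simp only [alphaCoeff, map_sub, hcomm, Finset.sum_sub_distrib, ← map_sum, hsum]
    -- The two full products of shifted factors cancel, leaving the difference of the unshifted
    -- ones.
    rw [hrel]
    abel
  rw [heq]
  exact (h.isCoeff_piTilde.compose (fun f _ _ h => h.factor f) _).sub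
    (h.isCoeff_monomial_smul l (h.isCoeff_piTilde.compose (fun f _ _ h => h.factor f) _))

/-- The divergence `∑ w_ρ = d` of the Euler field cancels the degree `-d` of the inverse polynomial.
-/
theorem lieDerivOp_euler_coeff_zero :
    lieDerivOp h.regularOpens (eulerCoeff w) (h.coeff 0) = 0 := by
  refine AnalyticFun.ext_of_mem fun p hp => ?_
  have hd : (deg w : ℂ) ≠ 0 := by
    have : 0 < deg w := Finset.sum_pos (fun ρ _ => h.pos ρ) Finset.univ_nonempty
    exact_mod_cast this.ne'
  have hμ : ∀ k, ∑ ρ, (expo w u k ρ : ℂ) * ((w ρ : ℂ) / (deg w : ℂ) *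
      ((0 : Idx N → ℂ) origin - (0 : Idx N → ℂ) (vertex ρ)) + eulerCoeff w ρ) = deg w := by
    intro k
    have := congrArg (· * (deg w : ℂ)) (sum_expo_mul_weight_div_deg h.pos h.last h.fermat h.enum k)
    simp only [Finset.sum_mul, one_mul] at this
    rw [← this]
    refine Finset.sum_congr rfl fun ρ _ => ?_
    simp only [Pi.zero_apply, eulerCoeff]
    field_simp
    ring
  have h₁ : (lieDerivOp h.regularOpens (eulerCoeff w) (h.coeff 0)) p =
      fderiv ℂ (h.coeff 0) p (scaling 0 (eulerCoeff w) p) +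
        (∑ ρ, eulerCoeff w ρ) * h.coeff 0 p := by
    rw [← lieOp_apply _ _ hp]
    rfl
  rw [h₁, h.fderiv_coeff 0 hp _ _ hμ, AnalyticFun.zero_apply]
  simp [eulerCoeff, deg]

/-- Euler invariance passes from the normalized form to the `α_i`, because the Euler operator
commutes with the cofactors and with multiplication by `a^l`. -/
theorem lieDerivOp_euler_alphaCoeff (l : Idx N → ℤ) (i : Fin 5) :
    lieDerivOp h.regularOpens (eulerCoeff w) (h.alphaCoeff l i) = 0 := by
  have hcof : ∀ fs, lieDerivOp h.regularOpens (eulerCoeff w)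
      (lieCofactorOp w h.regularOpens i fs (h.coeff 0)) = 0 := by
    intro fs
    have := congrArg (fun T : Module.End ℂ (AnalyticFun h.regularOpens) => T (h.coeff 0))
      (commute_lieCofactorOp w (fun s c =>
        lieOp_commute_lieDerivOp (S := h.regularOpens) s c (eulerCoeff w)) i fs).eq
    simp only [Module.End.mul_apply, h.lieDerivOp_euler_coeff_zero, map_zero] at this
    exact this.symm
  have hcomm := congrArg (fun T : Module.End ℂ (AnalyticFun h.regularOpens) =>
      T (lieCofactorOp w h.regularOpens i (factors (-l)) (h.coeff 0)))
    (h.commute_lieDerivOp_monomialOp l (eulerCoeff w)).eq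
  simp only [Module.End.mul_apply, hcof, map_zero] at hcomm
  rw [alphaCoeff, map_sub, hcof, hcomm, sub_zero]

end IsToricData

/-! ### From coefficients back to forms: holomorphy and closedness -/

section Consequences

theorem differentiableOn_contractSum {w : Fin 5 → ℕ} {N : ℕ} {s : Set ((Idx N → ℂ) × Vec)}
    {α : Fin 5 → Family N 4}
    (hα : ∀ i, DifferentiableOn ℂ (fun p : (Idx N → ℂ) × Vec => α i p.1 p.2) s) :
    DifferentiableOn ℂ (fun p : (Idx N → ℂ) × Vec => contractSum w (fun i => α i p.1) p.2) s := by
  simp only [contractSum_apply]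
  refine DifferentiableOn.fun_sum fun i _ p hp => ?_
  have h₂ : DifferentiableWithinAt ℂ (fun p : (Idx N → ℂ) × Vec =>
      diagField (coordCoeff w i) p.2) s p := by
    simp only [diagField_eq]
    exact ((diag _).differentiableAt.comp p differentiableAt_snd).differentiableWithinAt
  exact differentiableWithinAt_curryLeft_apply (k := 3) (hα i p hp) h₂

theorem differentiableAt_slice_right {N k : ℕ} {F : Family N k} {s : Set ((Idx N → ℂ) × Vec)}
    (hF : DifferentiableOn ℂ (fun p : (Idx N → ℂ) × Vec => F p.1 p.2) s)
    {a : Idx N → ℂ} {z : Vec} (hs : s ∈ 𝓝 (a, z)) : DifferentiableAt ℂ (F a) z :=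
  DifferentiableAt.comp (g := fun p : (Idx N → ℂ) × Vec => F p.1 p.2) z
    (hF.differentiableAt hs) (hasFDerivAt_prodMk_right a z).differentiableAt

variable {w : Fin 5 → ℕ} {N : ℕ} {S : Opens ((Idx N → ℂ) × Vec)} {F : Family N 4}
  {g : AnalyticFun S}

theorem IsCoeff.differentiableOn (hF : IsCoeff w F g) :
    DifferentiableOn ℂ (fun p : (Idx N → ℂ) × Vec => F p.1 p.2) S := by
  have : DifferentiableOn ℂ (fun p : (Idx N → ℂ) × Vec => g p • omegaZero w p.2)
      (S : Set ((Idx N → ℂ) × Vec)) := fun p hp =>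
    ((g.differentiableAt hp).smul
      ((differentiable_omegaZero w p.2).comp p differentiableAt_snd)).differentiableWithinAt
  exact this.congr hF

theorem IsCoeff.differentiableAt (hF : IsCoeff w F g) {p : (Idx N → ℂ) × Vec} (hp : p ∈ S) :
    DifferentiableAt ℂ (F p.1) p.2 :=
  (((hasFDerivAt_slice_right g hp).differentiableAt).smul
    (differentiable_omegaZero w p.2)).congr_of_eventuallyEq (hF.eventuallyEq_right hp)

/-- The coefficient of `d(g Ω_0)` is the Euler operator applied to `g`. -/
theorem IsCoeff.extDeriv_eq_zero (hF : IsCoeff w F g)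
    (hg : lieDerivOp S (eulerCoeff w) g = 0) {p : (Idx N → ℂ) × Vec} (hp : p ∈ S) :
    extDeriv (F p.1) p.2 = 0 := by
  have h₁ := hasFDerivAt_slice_right g hp
  rw [(hF.eventuallyEq_right hp).extDeriv_eq, extDeriv_smul_omegaZero w h₁.differentiableAt,
    h₁.fderiv]
  have h₂ : (lieDerivOp S (eulerCoeff w) g) p =
      fderiv ℂ g p (scaling 0 (eulerCoeff w) p) + (∑ ρ, eulerCoeff w ρ) * g p := by
    rw [← lieOp_apply _ _ hp]
    rfl
  rw [hg, AnalyticFun.zero_apply, scaling_apply, zero_mul] at h₂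
  change (fderiv ℂ g p (0, diagField (eulerCoeff w) p.2) + _) • volForm = 0
  rw [← h₂]
  exact zero_smul ℂ volForm

end Consequences

/-! ### The assertions about `α_i` and `β_l` -/

namespace IsToricData

variable {w : Fin 5 → ℕ} {N : ℕ} {u : Fin N → Fin 4 → ℤ} {lam : Fin 5 → (Idx N → ℂ) → ℂ}
  {U : Set (Idx N → ℂ)}

theorem differentiableOn_beta (h : IsToricData w u U lam) (l : Idx N → ℤ) :
    DifferentiableOn ℂ (fun p : (Idx N → ℂ) × Vec => beta w u lam l p.1 p.2)
      (regularSet w u U lam) := by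
  have hα : ∀ i, DifferentiableOn ℂ (fun p : (Idx N → ℂ) × Vec => alpha w u lam l i p.1 p.2)
      (regularSet w u U lam) := fun i => (h.isCoeff_alpha l i).differentiableOn
  simp only [beta]
  exact differentiableOn_contractSum hα

theorem extDeriv_alpha (h : IsToricData w u U lam) (l : Idx N → ℤ) (i : Fin 5)
    {a : Idx N → ℂ} {z : Vec} (hp : (a, z) ∈ regularSet w u U lam) :
    extDeriv (alpha w u lam l i a) z = 0 :=
  (h.isCoeff_alpha l i).extDeriv_eq_zero (h.lieDerivOp_euler_alphaCoeff l i)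
    (p := (a, z)) hp

theorem gkz_piTilde_eq_neg_sum_lieDeriv (h : IsToricData w u U lam)
    {l : Idx N → ℤ} (hl : l ∈ relationLattice w u)
    {a : Idx N → ℂ} {z : Vec} (hp : (a, z) ∈ regularSet w u U lam) :
    gkz l (piTilde w u lam) a z = -∑ i, lieDeriv (coordCoeff w i) (alpha w u lam l i a) z := by
  have h₁ := (IsCoeff.sum Finset.univ fun i _ =>
    (h.isCoeff_alpha l i).lieDeriv (coordCoeff w i)).neg (a, z) hp
  rw [h.isCoeff_gkz hl (a, z) hp, ← h₁]
  simp

theorem gkz_piTilde_eq_neg_extDeriv_beta (h : IsToricData w u U lam)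
    {l : Idx N → ℤ} (hl : l ∈ relationLattice w u)
    {a : Idx N → ℂ} {z : Vec} (hp : (a, z) ∈ regularSet w u U lam) :
    gkz l (piTilde w u lam) a z = -extDeriv (beta w u lam l a) z := by
  rw [h.gkz_piTilde_eq_neg_sum_lieDeriv hl hp, beta, extDeriv_contractSum w
    (fun i => (h.isCoeff_alpha l i).differentiableAt (p := (a, z)) hp)
    fun i => h.extDeriv_alpha l i hp]

theorem interior_euler_beta (h : IsToricData w u U lam) (l : Idx N → ℤ) {a : Idx N → ℂ} {z : Vec}
    (hp : (a, z) ∈ regularSet w u U lam) :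
    interior (diagField (eulerCoeff w)) (beta w u lam l a) z = 0 :=
  interior_euler_contractSum w _ fun i => h.isCoeff_alpha l i (a, z) hp

theorem lieDeriv_euler_beta (h : IsToricData w u U lam)
    {l : Idx N → ℤ} (hl : l ∈ relationLattice w u)
    {a : Idx N → ℂ} {z : Vec} (hp : (a, z) ∈ regularSet w u U lam) :
    lieDeriv (eulerCoeff w) (beta w u lam l a) z = 0 := by
  have hopen : regularSet w u U lam ∈ 𝓝 (a, z) := h.regularOpens.isOpen.mem_nhds hp
  have hdiff : DifferentiableAt ℂ (beta w u lam l a) z :=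
    differentiableAt_slice_right (h.differentiableOn_beta l) hopen
  have hzero : interior (diagField (eulerCoeff w)) (beta w u lam l a) =ᶠ[𝓝 z] 0 := by
    filter_upwards [(Continuous.prodMk_right a).continuousAt.eventually hopen] with y hy
      using h.interior_euler_beta l hy
  have hd : ∃ c : ℂ, extDeriv (beta w u lam l a) z = c • omegaZero w z := by
    have h₁ := h.gkz_piTilde_eq_neg_extDeriv_beta hl hp
    rw [h.isCoeff_gkz hl (a, z) hp] at h₁
    exact ⟨_, (neg_eq_iff_eq_neg.2 h₁).symm.trans (neg_smul _ _).symm⟩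
  obtain ⟨c, hc⟩ := hd
  exact lieDeriv_euler_eq_zero w hdiff hzero hc

end IsToricData

end BetaTerm

end

theorem mainTheorem4
    (w : Fin 5 → ℕ) (hpos : ∀ ρ, 0 < w ρ) (hlast : w (Fin.last 4) = 1)
    (hfermat : ∀ ρ, w ρ ∣ BetaTerm.deg w)
    (N : ℕ) (u : Fin N → Fin 4 → ℤ) (hu : BetaTerm.IsEnumeration w u)
    (U : Set (BetaTerm.Idx N → ℂ)) (hU : IsOpen U) (hU0 : ∀ a ∈ U, ∀ k, a k ≠ 0)
    (lam : Fin 5 → (BetaTerm.Idx N → ℂ) → ℂ) (hlam : BetaTerm.IsLogBranch U lam)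
    (l : BetaTerm.Idx N → ℤ) (hl : l ∈ BetaTerm.relationLattice w u) :
    -- the forms are holomorphic in `(a, z)` off the polar locus, which is closed
    IsOpen (BetaTerm.regularSet w u U lam) ∧
    DifferentiableOn ℂ (fun p => BetaTerm.piTilde w u lam p.1 p.2)
      (BetaTerm.regularSet w u U lam) ∧
    (∀ i, DifferentiableOn ℂ (fun p => BetaTerm.alpha w u lam l i p.1 p.2)
      (BetaTerm.regularSet w u U lam)) ∧
    DifferentiableOn ℂ (fun p => BetaTerm.beta w u lam l p.1 p.2)
      (BetaTerm.regularSet w u U lam) ∧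
    ∀ a z, (a, z) ∈ BetaTerm.regularSet w u U lam →
      -- the `α_i` are closed
      (∀ i, extDeriv (BetaTerm.alpha w u lam l i a) z = 0) ∧
      -- the Lie derivative form of the equation
      BetaTerm.gkz l (BetaTerm.piTilde w u lam) a z =
        -∑ i, BetaTerm.lieDeriv (BetaTerm.coordCoeff w i) (BetaTerm.alpha w u lam l i a) z ∧
      -- the `β`-term formula
      BetaTerm.gkz l (BetaTerm.piTilde w u lam) a z =
        -extDeriv (BetaTerm.beta w u lam l a) z ∧
      -- `β_l` is horizontal and invariant for the Euler field, so it descends to `ℙ⁴(w)`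
      BetaTerm.interior (BetaTerm.diagField (BetaTerm.eulerCoeff w))
        (BetaTerm.beta w u lam l a) z = 0 ∧
      BetaTerm.lieDeriv (BetaTerm.eulerCoeff w) (BetaTerm.beta w u lam l a) z = 0 ∧
      -- the same formula for any other choice of closed forms `α_i`
      (∀ α : Fin 5 → BetaTerm.Form 4,
        (∀ i, DifferentiableAt ℂ (α i) z) → (∀ i, extDeriv (α i) z = 0) →
        BetaTerm.gkz l (BetaTerm.piTilde w u lam) a z =
          -∑ i, BetaTerm.lieDeriv (BetaTerm.coordCoeff w i) (α i) z →
        BetaTerm.gkz l (BetaTerm.piTilde w u lam) a z =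
          -extDeriv (BetaTerm.contractSum w α) z) := by
  have h : BetaTerm.IsToricData w u U lam := ⟨hpos, hlast, hfermat, hu, hU, hU0, hlam⟩
  exact ⟨h.regularOpens.isOpen, h.isCoeff_piTilde.differentiableOn,
    fun i => (h.isCoeff_alpha l i).differentiableOn, h.differentiableOn_beta l,
    fun a z hp => ⟨fun i => h.extDeriv_alpha l i hp, h.gkz_piTilde_eq_neg_sum_lieDeriv hl hp,
      h.gkz_piTilde_eq_neg_extDeriv_beta hl hp, h.interior_euler_beta l hp,
      h.lieDeriv_euler_beta hl hp, fun α hα hd hgkz => by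
        rw [hgkz, BetaTerm.extDeriv_contractSum w hα hd]⟩⟩
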